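/- Let $m\ge 0$, let $\mathcal I$ and $\mathcal J$ be two disjoint families of non-empty subsets of $\{1,\dots,m\}$, and let $\lambda_I$ ($I\in\mathcal I$) and $\mu_J$ ($J\in\mathcal J$) be positive reals. Consider the following two statements. (E) For all jointly distributed random variables $\xi_1,\dots,\xi_m$ with finite ranges, $$\sum_{I\in\mathcal I}\lambda_I H(\xi_I)\le\sum_{J\in\mathcal J}\mu_J H(\xi_J),$$ where $\xi_I=\langle \xi_i\mid i\in I\rangle$ and $H$ is Shannon entropy. (D) For every set $S\subset\mathbb R^m$ and all reals $a_I\ge 0$ ($I\in\mathcal I$) with $$\sum_{J\in\mathcal J}\mu_J\dim_p S_J\le\sum_{I\in\mathcal I}\lambda_I a_I$$ there is a splitting $S=\bigcup_{I\in\mathcal I}S^I$ such that $\dim_H\big((S^I)_I\big)\le a_I$ for all $I\in\mathcal I$. Here $X_I\subset\mathbb R^I$ denotes the projection of $X\subset\mathbb R^m$ onto the $I$-coordinates, and $\dim_p$, $\dim_H$ are packing and Hausdorff dimension. Then: 1. If (E) is false, then (D) is false. 2. Moreover, if (E) is false, then there are a finite group $G$ with subgroups $H_1,\dots,H_m$,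 an integer $N\ge 2$ and injections $e_i\colon G/H_i\to\{0,\dots,N-1\}$ such that the inequality in (E) fails for the random variables $\xi_i=gH_i$, where $g$ is uniformly distributed in $G$, and the claim in (D) fails for $S=C_A$, where $A=\{(e_1(gH_1),\dots,e_m(gH_m)) : g\in G\}\subset\{0,\dots,N-1\}^m$ and $C_A\subset[0,1]^m$ is the set of all points $(x^1,\dots,x^m)$ whose coordinates have $N$-ary expansions $x^i=0.x^i_1x^i_2\dots$ with $(x^1_k,\dots,x^m_k)\in A$ for every $k$. 3. Consequently, if $\mathcal I\neq\emptyset$, then (E) is true if and only if (D) is true. -/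

import Mathlib

open MeasureTheory Set Filter Topology
open scoped NNReal ENNReal

noncomputable section

namespace EntropyDim

/-! ### Shannon entropy -/

/-- Shannon entropy `∑ₐ p(a) log (1 / p(a))`, `p(a) = P(X = a)`, of a random variable with values in
a finite type. The logarithm is natural; the base does not matter below, since only homogeneous
linear inequalities between entropies are considered. -/
def shannonEntropy {Ω β : Type} [MeasurableSpace Ω] [Finite β] (P : Measure Ω) (X : Ω → β) : ℝ :=
  ∑ᶠ b : β, Real.negMulLog (P.real (X ⁻¹' {b}))

/-- The sub-tuple `ξ_I = ⟨ξ_i | i ∈ I⟩` of a tuple of random variables. -/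
def subTuple {m : ℕ} {Ω : Type} {α : Fin m → Type} (ξ : ∀ i, Ω → α i) (I : Finset (Fin m)) :
    Ω → ((i : I) → α i) :=
  fun ω i => ξ i ω

/-- The inequality `∑_{I ∈ 𝓘} λ_I H(ξ_I) ≤ ∑_{J ∈ 𝓙} μ_J H(ξ_J)` is true for all jointly distributed
random variables `ξ_1, …, ξ_m` with finite ranges. -/
def EntropyInequality {m : ℕ} (𝓘 𝓙 : Finset (Finset (Fin m))) (lam mu : Finset (Fin m) → ℝ≥0) :
    Prop :=
  ∀ (Ω : Type) [MeasurableSpace Ω] (P : Measure Ω) [IsProbabilityMeasure P]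
    (α : Fin m → Type) [∀ i, Finite (α i)] [∀ i, MeasurableSpace (α i)]
    [∀ i, MeasurableSingletonClass (α i)] (ξ : ∀ i, Ω → α i), (∀ i, Measurable (ξ i)) →
    ∑ I ∈ 𝓘, (lam I : ℝ) * shannonEntropy P (subTuple ξ I) ≤
      ∑ J ∈ 𝓙, (mu J : ℝ) * shannonEntropy P (subTuple ξ J)

/-! ### Coset variables of a group with subgroups -/

/-- The tuple of cosets `g ↦ (g H_1, …, g H_m)`. -/
def cosetTuple {m : ℕ} {G : Type} [Group G] (H : Fin m → Subgroup G) : ∀ i, G → G ⧸ H i :=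
  fun _ g => QuotientGroup.mk g

/-- The entropy of `⟨g H_i | i ∈ I⟩` for `g` uniformly distributed in the finite group `G`. -/
def cosetEntropy {m : ℕ} {G : Type} [Group G] [Finite G] (H : Fin m → Subgroup G)
    (I : Finset (Fin m)) : ℝ :=
  letI : MeasurableSpace G := ⊤
  shannonEntropy (ProbabilityTheory.uniformOn (univ : Set G)) (subTuple (cosetTuple H) I)

/-! ### Box and packing dimension -/

/-- Upper box-counting dimension `limsup_{r → 0+} log N_r(s) / log (1 / r)`, where `N_r(s)` is the
least number of closed balls of radius `r` that cover `s` (and `0` for the empty set). -/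
def upperBoxDim {X : Type} [PseudoEMetricSpace X] (s : Set X) : ℝ≥0∞ :=
  (limsup (fun r : ℝ≥0 =>
    ENNReal.log ((Metric.externalCoveringNumber r s : ℕ∞) : ℝ≥0∞) /
      ((Real.log (1 / (r : ℝ)) : ℝ) : EReal)) (𝓝[>] 0)).toENNReal

/-- Packing dimension, as the modified (countably stabilized) upper box-counting dimension: the
infimum over all countable covers of `s` of the supremum of the upper box-counting dimensions of
their members. -/
def packingDim {X : Type} [PseudoEMetricSpace X] (s : Set X) : ℝ≥0∞ :=
  ⨅ (t : ℕ → Set X) (_ : s ⊆ ⋃ k, t k), ⨆ k, upperBoxDim (t k)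

/-! ### The statement about dimensions

`ℝ^I` is `I → ℝ` with the maximum norm, which is bi-Lipschitz equivalent to the Euclidean norm and
hence gives the same Hausdorff and packing dimensions. -/

/-- The projection `S_I` of `S ⊆ ℝ^m` onto the `I`-coordinates, a subset of `ℝ^I`. -/
def proj {m : ℕ} (I : Finset (Fin m)) (S : Set (Fin m → ℝ)) : Set (I → ℝ) :=
  (fun x (i : I) => x i) '' S

/-- The statement about dimensions for one set `S`: for all reals `a_I ≥ 0` with
`∑_{J ∈ 𝓙} μ_J dim_p S_J ≤ ∑_{I ∈ 𝓘} λ_I a_I` there is a splitting `S = ⋃_{I ∈ 𝓘} S^I` such that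
`dim_H (S^I)_I ≤ a_I` for every `I ∈ 𝓘`. -/
def DimensionStatementFor {m : ℕ} (𝓘 𝓙 : Finset (Finset (Fin m)))
    (lam mu : Finset (Fin m) → ℝ≥0) (S : Set (Fin m → ℝ)) : Prop :=
  ∀ a : Finset (Fin m) → ℝ≥0,
    ∑ J ∈ 𝓙, (mu J : ℝ≥0∞) * packingDim (proj J S) ≤ ∑ I ∈ 𝓘, (lam I : ℝ≥0∞) * (a I : ℝ≥0∞) →
    ∃ T : Finset (Fin m) → Set (Fin m → ℝ),
      S = ⋃ I ∈ 𝓘, T I ∧ ∀ I ∈ 𝓘, dimH (proj I (T I)) ≤ (a I : ℝ≥0∞)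

/-- The statement about dimensions: it holds for every set `S ⊆ ℝ^m`. -/
def DimensionStatement {m : ℕ} (𝓘 𝓙 : Finset (Finset (Fin m)))
    (lam mu : Finset (Fin m) → ℝ≥0) : Prop :=
  ∀ S : Set (Fin m → ℝ), DimensionStatementFor 𝓘 𝓙 lam mu S

/-! ### Cantor-type sets -/

/-- For `A ⊆ {0, …, N-1}^m`, the set `C_A ⊆ [0,1]^m` of all points whose coordinates have `N`-ary
expansions such that, for every position `k`, the tuple of the `k`-th digits is in `A`. -/
def cantorSet {m : ℕ} (N : ℕ) (A : Set (Fin m → Fin N)) : Set (Fin m → ℝ) :=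
  {x | ∃ d : ℕ → Fin m → Fin N, (∀ k, d k ∈ A) ∧ ∀ i, x i = Real.ofDigits (fun k => d k i)}

/-- The digit set `A = {(g H_1, …, g H_m) : g ∈ G}`, where the cosets of `H_i` are identified with
elements of `{0, …, N-1}` by means of `e i`. -/
def cosetDigits {m N : ℕ} {G : Type} [Group G] (H : Fin m → Subgroup G)
    (e : ∀ i, (G ⧸ H i) ↪ Fin N) : Set (Fin m → Fin N) :=
  range fun (g : G) (i : Fin m) => e i (cosetTuple H i g)

end EntropyDim

end

/-!
# Entropy inequalities and splittings of sets in Euclidean space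

If the inequality for entropies holds, sets split as follows. Let `A` be a finite set of tuples, and
choose weights `q` on `A` that maximise `∑ λ_I H(ξ_I)`. The maximum is at most
`∑ μ_J H(ξ_J) ≤ ∑ μ_J log |A_J|`, and the first-order condition at `q` says that
`∑ λ_I log (1 / q_I(x_I))` is at most the maximum for *every* `x ∈ A`. Hence, if
`∑ μ_J log |A_J| ≤ ∑ λ_I a_I`, each `x ∈ A` has an `I` with `q_I(x_I) ≥ exp (-a_I)`, and for each `I`
there are at most `exp a_I` such values `x_I` (`EntropyInequality.exists_splitting`). This is
applied to the dyadic cubes of side `2⁻ⁿ` that meet `S`, for every `n`, after `S` has been cut into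
countably many pieces whose projections have upper box dimension close to the packing dimension. A
point is put into the part for `I` if its cube is assigned to `I` at infinitely many scales, which
bounds the Hausdorff dimension of the projected part (`EntropyInequality.dimensionStatement`).

If the inequality for entropies fails, it fails for some distribution on a finite set for which no
variable is constant. Take `⌊n p(ω)⌋` copies of each `ω` and let the group of permutations of the
copies act; the subgroups are the stabilizers of the labellings by the variables. The numbers of
cosets are multinomial coefficients, so coset entropies divided by `n` tend to the given entropies
(`exists_tendsto_cosetEntropy`), and for large `n` the coset variables violate the inequality and
are not constant.

For a Cantor-type set of coset digits, the projection to the `I`-coordinates has upper box dimension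
at most `H_I / log N`, with `H_I` the coset entropy. Coset variables are uniformly distributed on
their range, so a sequence of independent uniform group elements gives each cylinder of length `n`
of the projection mass at most `exp (-n H_I)`. By the mass distribution principle, a subset of the
projection of Hausdorff dimension less than `H_I / log N` is null
(`uniformSeq_preimage_eq_zero_of_dimH_lt`). A splitting with all dimensions less than these values
would cover a space of measure one by finitely many null sets
(`not_dimensionStatementFor_cantorSet`).
-/

namespace EntropyDim

/-! ### Entropy of functions on a finite set of weights -/

/-- The distribution of `f` under the weights `p` on the finite type `Ω`, evaluated at `b`. -/
noncomputable def pushWeight {Ω β : Type*} [Fintype Ω] (p : Ω → ℝ) (f : Ω → β) (b : β) : ℝ :=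
  open Classical in ∑ ω with f ω = b, p ω

/-- The Shannon entropy of `f` under the weights `p` on the finite type `Ω`. -/
noncomputable def pushEntropy {Ω β : Type*} [Fintype Ω] [Fintype β] (p : Ω → ℝ) (f : Ω → β) : ℝ :=
  ∑ b, Real.negMulLog (pushWeight p f b)

section
variable {Ω β : Type*} [Fintype Ω]

lemma pushWeight_nonneg {p : Ω → ℝ} (hp : ∀ ω, 0 ≤ p ω) (f : Ω → β) (b : β) :
    0 ≤ pushWeight p f b :=
  Finset.sum_nonneg fun ω _ => hp ω

lemma le_pushWeight {p : Ω → ℝ} (hp : ∀ ω, 0 ≤ p ω) (f : Ω → β) (ω : Ω) :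
    p ω ≤ pushWeight p f (f ω) := by
  classical
  exact Finset.single_le_sum (f := p) (fun ω _ => hp ω) (by simp)

lemma sum_pushWeight [Fintype β] (p : Ω → ℝ) (f : Ω → β) : ∑ b, pushWeight p f b = ∑ ω, p ω := by
  classical
  simp only [pushWeight]
  exact Finset.sum_fiberwise _ _ _

lemma pushWeight_le_one [Fintype β] {p : Ω → ℝ} (hp : p ∈ stdSimplex ℝ Ω) (f : Ω → β) (b : β) :
    pushWeight p f b ≤ 1 := by
  rw [← hp.2, ← sum_pushWeight p f]
  exact Finset.single_le_sum (f := pushWeight p f) (fun b _ => pushWeight_nonneg hp.1 f b)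
    (Finset.mem_univ b)

lemma pushWeight_add_smul (s t : ℝ) (p q : Ω → ℝ) (f : Ω → β) (b : β) :
    pushWeight (s • p + t • q) f b = s * pushWeight p f b + t * pushWeight q f b := by
  simp [pushWeight, Finset.sum_add_distrib, Finset.mul_sum]

lemma pushWeight_single [DecidableEq Ω] [DecidableEq β] (x : Ω) (f : Ω → β) (b : β) :
    pushWeight (Pi.single x 1) f b = if f x = b then 1 else 0 := by
  simp [pushWeight]

lemma continuous_pushWeight (f : Ω → β) (b : β) : Continuous fun p : Ω → ℝ => pushWeight p f b := by
  unfold pushWeight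
  fun_prop

lemma continuous_pushEntropy [Fintype β] (f : Ω → β) :
    Continuous fun p : Ω → ℝ => pushEntropy p f := by
  unfold pushEntropy
  exact continuous_finsetSum _ fun b _ =>
    Real.continuous_negMulLog.comp (continuous_pushWeight f b)

/-- A variable has positive entropy if the weights are positive and it takes two values. -/
lemma pushEntropy_pos [Fintype β] {p : Ω → ℝ} (hp : p ∈ stdSimplex ℝ Ω) (hpos : ∀ ω, 0 < p ω)
    (f : Ω → β) {x y : Ω} (hxy : f x ≠ f y) : 0 < pushEntropy p f := by
  classical
  have h0 : 0 < pushWeight p f (f x) := (hpos x).trans_le (le_pushWeight hp.1 f x)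
  have h1 : 0 < pushWeight p f (f y) := (hpos y).trans_le (le_pushWeight hp.1 f y)
  have h2 : pushWeight p f (f x) + pushWeight p f (f y) ≤ 1 := by
    rw [← hp.2, ← sum_pushWeight p f, ← Finset.sum_pair hxy]
    exact Finset.sum_le_sum_of_subset_of_nonneg (Finset.subset_univ _)
      fun b _ _ => pushWeight_nonneg hp.1 f b
  refine Finset.sum_pos' (fun b _ => Real.negMulLog_nonneg (pushWeight_nonneg hp.1 f b)
    (pushWeight_le_one hp f b)) ⟨f x, Finset.mem_univ _, ?_⟩
  have := Real.log_neg h0 (by linarith)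
  rw [Real.negMulLog]
  nlinarith

/-- Gibbs' inequality: cross entropy is at least entropy. -/
lemma sum_negMulLog_le_crossEntropy [Fintype β] {u v : β → ℝ} (hu : ∀ b, 0 ≤ u b)
    (hv : ∀ b, 0 ≤ v b) (huv : ∀ b, 0 < u b → 0 < v b) (hle : ∑ b, v b ≤ ∑ b, u b) :
    ∑ b, Real.negMulLog (u b) ≤ ∑ b, u b * -Real.log (v b) := by
  have h : ∀ b, Real.negMulLog (u b) - u b * -Real.log (v b) ≤ v b - u b := by
    intro b
    rcases (hu b).eq_or_lt with h | h
    · simp [← h, hv b]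
    · have h' := huv b h
      have := mul_le_mul_of_nonneg_left (Real.log_le_sub_one_of_pos (div_pos h' h)) h.le
      rw [Real.log_div h'.ne' h.ne', mul_sub, mul_sub, mul_div_cancel₀ _ h.ne'] at this
      rw [Real.negMulLog]
      linarith
  have := Finset.sum_le_sum fun b (_ : b ∈ Finset.univ) => h b
  simp only [Finset.sum_sub_distrib] at this
  linarith

/-- The entropy of a variable is at most the logarithm of the number of its values. -/
lemma pushEntropy_le_log_ncard_range [Fintype β] {p : Ω → ℝ} (hp : p ∈ stdSimplex ℝ Ω)
    (f : Ω → β) : pushEntropy p f ≤ Real.log (range f).ncard := by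
  classical
  have hΩ : Nonempty Ω := by
    by_contra h
    rw [not_nonempty_iff] at h
    simpa using hp.2
  have hc : 0 < ((range f).ncard : ℝ) := by
    exact_mod_cast (Set.ncard_pos (Set.toFinite _)).2 (range_nonempty f)
  have hout : ∀ b, b ∉ range f → pushWeight p f b = 0 := fun b hb => by
    rw [pushWeight, Finset.sum_eq_zero]
    intro ω hω
    exact absurd ⟨ω, (Finset.mem_filter.1 hω).2⟩ hb
  have hs : ∑ b, pushWeight p f b = 1 := (sum_pushWeight p f).trans hp.2
  have := sum_negMulLog_le_crossEntropy (u := pushWeight p f)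
    (v := fun b => if b ∈ range f then ((range f).ncard : ℝ)⁻¹ else 0)
    (pushWeight_nonneg hp.1 f) (fun b => by split_ifs <;> positivity)
    (fun b hb => by
      by_cases h : b ∈ range f
      · simp only [h, if_true]; positivity
      · simp [hout b h] at hb)
    (by
      rw [hs, ← Finset.sum_filter, Finset.sum_const, ← Set.ncard_coe_finset]
      simp only [Finset.coe_filter, Finset.mem_univ, true_and, Set.ofPred_mem_eq, nsmul_eq_mul]
      rw [mul_inv_cancel₀ hc.ne'])
  refine this.trans_eq ?_
  have h2 : ∀ b, pushWeight p f b *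
      -Real.log (if b ∈ range f then ((range f).ncard : ℝ)⁻¹ else 0) =
      pushWeight p f b * Real.log (range f).ncard := fun b => by
    by_cases h : b ∈ range f
    · simp [h, Real.log_inv]
    · simp [hout b h]
  rw [Finset.sum_congr rfl fun b _ => h2 b, ← Finset.sum_mul, hs, one_mul]

end

/-- The law of a random variable with finitely many values determines the entropy of all its
functions. -/
lemma shannonEntropy_comp {Ω X β : Type} [MeasurableSpace Ω] [Fintype X] [Fintype β]
    (P : Measure Ω) [IsFiniteMeasure P] (ξ : Ω → X) (hξ : ∀ x, MeasurableSet (ξ ⁻¹' {x}))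
    (f : X → β) :
    shannonEntropy P (fun ω => f (ξ ω)) = pushEntropy (fun x => P.real (ξ ⁻¹' {x})) f := by
  classical
  rw [shannonEntropy, finsum_eq_sum_of_fintype, pushEntropy]
  refine Finset.sum_congr rfl fun b _ => congrArg _ ?_
  rw [pushWeight, ← measureReal_biUnion_finset]
  · congr 1
    ext ω
    simp
  · intro x _ y _ hxy
    exact Disjoint.preimage ξ (by simpa using hxy)
  · exact fun x _ => hξ x

/-- The inequality for entropies, for a finite probability space given by its weights. -/
lemma EntropyInequality.pushEntropy_le {m : ℕ} {𝓘 𝓙 : Finset (Finset (Fin m))}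
    {lam mu : Finset (Fin m) → ℝ≥0} (hE : EntropyInequality 𝓘 𝓙 lam mu) {Ω : Type} [Fintype Ω]
    {p : Ω → ℝ} (hp : p ∈ stdSimplex ℝ Ω) {α : Fin m → Type} [∀ i, Fintype (α i)]
    (ξ : ∀ i, Ω → α i) :
    ∑ I ∈ 𝓘, (lam I : ℝ) * pushEntropy p (subTuple ξ I) ≤
      ∑ J ∈ 𝓙, (mu J : ℝ) * pushEntropy p (subTuple ξ J) := by
  classical
  let _ : MeasurableSpace Ω := ⊤
  let _ : ∀ i, MeasurableSpace (α i) := fun _ => ⊤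
  have hsum : ∑ ω, ENNReal.ofReal (p ω) = 1 := by
    rw [← ENNReal.ofReal_sum_of_nonneg fun ω _ => hp.1 ω, hp.2, ENNReal.ofReal_one]
  let P := (PMF.ofFintype (fun ω => ENNReal.ofReal (p ω)) hsum).toMeasure
  have key : ∀ I, shannonEntropy P (subTuple ξ I) = pushEntropy p (subTuple ξ I) := fun I => by
    have := shannonEntropy_comp P (id : Ω → Ω) (fun _ => trivial) (subTuple ξ I)
    simp only [id] at this
    rw [show (fun ω => subTuple ξ I ω) = subTuple ξ I from rfl] at this
    rw [this]
    congr 1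
    ext ω
    rw [preimage_id, Measure.real, PMF.toMeasure_apply_singleton _ _ (by trivial),
      PMF.ofFintype_apply,
      ENNReal.toReal_ofReal (hp.1 ω)]
  have := hE Ω P α ξ fun i => measurable_from_top
  simpa only [key] using this

/-! ### Splitting a finite set -/

section
variable {Ω : Type*} [Fintype Ω]

/-- Cross entropy against the weights moved from `q` towards the point `x`. This is the first-order
condition for a maximum of the concave function `q ↦ ∑ λᵢ H(fᵢ)` at `q`; the finite step `t`
avoids derivatives at points where a weight vanishes. -/
lemma sum_neg_log_le_of_isMaxOn {ι : Type*} {s : Finset ι} {lam : ι → ℝ} (hlam : ∀ i ∈ s, 0 ≤ lam i)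
    {β : ι → Type*} [∀ i, Fintype (β i)] [DecidableEq Ω] (f : ∀ i, Ω → β i) {q : Ω → ℝ}
    (hq : q ∈ stdSimplex ℝ Ω)
    (hmax : IsMaxOn (fun q => ∑ i ∈ s, lam i * pushEntropy q (f i)) (stdSimplex ℝ Ω) q)
    (x : Ω) {t : ℝ} (ht0 : 0 < t) (ht1 : t < 1) :
    ∑ i ∈ s, lam i * -Real.log ((1 - t) * pushWeight q (f i) (f i x) + t) ≤
      ∑ i ∈ s, lam i * pushEntropy q (f i) := by
  classical
  -- Compare `q` with the weights `r = (1 - t) q + t δₓ`: by Gibbs' inequality for `q` against `r`,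
  -- `H_r ≥ (1 - t) H_q - t log r(x)` for each variable.
  have hδ : (Pi.single x 1 : Ω → ℝ) ∈ stdSimplex ℝ Ω := single_mem_stdSimplex ℝ x
  have hr : (1 - t) • q + t • (Pi.single x 1 : Ω → ℝ) ∈ stdSimplex ℝ Ω :=
    convex_stdSimplex ℝ Ω hq hδ (by linarith) ht0.le (by ring)
  set r := (1 - t) • q + t • (Pi.single x 1 : Ω → ℝ) with hr_def
  have hrx : ∀ i, pushWeight r (f i) (f i x) = (1 - t) * pushWeight q (f i) (f i x) + t := fun i => by
    rw [hr_def, pushWeight_add_smul, pushWeight_single, if_pos rfl, mul_one]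
  have hterm : ∀ i, (1 - t) * pushEntropy q (f i) + t * -Real.log (pushWeight r (f i) (f i x)) ≤
      pushEntropy r (f i) := by
    intro i
    have hg := sum_negMulLog_le_crossEntropy (u := pushWeight q (f i)) (v := pushWeight r (f i))
      (pushWeight_nonneg hq.1 _) (pushWeight_nonneg hr.1 _)
      (fun b hb => by
        rw [hr_def, pushWeight_add_smul, pushWeight_single]
        have : 0 < (1 - t) * pushWeight q (f i) b := mul_pos (by linarith) hb
        split_ifs <;> nlinarith)
      (by rw [sum_pushWeight, sum_pushWeight, hr.2, hq.2])
    have he : pushEntropy r (f i) =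
        (1 - t) * ∑ b, pushWeight q (f i) b * -Real.log (pushWeight r (f i) b) +
          t * -Real.log (pushWeight r (f i) (f i x)) := by
      have : ∀ b, Real.negMulLog (pushWeight r (f i) b) =
          (1 - t) * (pushWeight q (f i) b * -Real.log (pushWeight r (f i) b)) +
          if f i x = b then t * -Real.log (pushWeight r (f i) b) else 0 := fun b => by
        rw [Real.negMulLog]
        have hb : pushWeight r (f i) b =
            (1 - t) * pushWeight q (f i) b + t * if f i x = b then 1 else 0 := by
          rw [hr_def, pushWeight_add_smul, pushWeight_single]
        nth_rewrite 1 [hb]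
        split_ifs <;> ring
      rw [pushEntropy, Finset.sum_congr rfl fun b _ => this b, Finset.sum_add_distrib,
        ← Finset.mul_sum, Finset.sum_ite_eq, if_pos (Finset.mem_univ _)]
    rw [he]
    have := mul_le_mul_of_nonneg_left hg (by linarith : 0 ≤ 1 - t)
    rw [pushEntropy]
    linarith
  have h1 : ∑ i ∈ s, lam i * ((1 - t) * pushEntropy q (f i) +
      t * -Real.log (pushWeight r (f i) (f i x))) ≤ ∑ i ∈ s, lam i * pushEntropy q (f i) :=
    (Finset.sum_le_sum fun i hi => mul_le_mul_of_nonneg_left (hterm i) (hlam i hi)).trans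
      (hmax hr)
  have h2 : ∑ i ∈ s, lam i * ((1 - t) * pushEntropy q (f i) +
      t * -Real.log (pushWeight r (f i) (f i x))) =
      (1 - t) * ∑ i ∈ s, lam i * pushEntropy q (f i) +
        t * ∑ i ∈ s, lam i * -Real.log (pushWeight r (f i) (f i x)) := by
    rw [Finset.mul_sum, Finset.mul_sum, ← Finset.sum_add_distrib]
    exact Finset.sum_congr rfl fun i _ => by ring
  rw [h2] at h1
  simp only [← hrx]
  refine le_of_mul_le_mul_left ?_ ht0
  linarith

/-- If `∑ λᵢ H(fᵢ) ≤ ∑ λᵢ aᵢ` for all weights on a finite set, then suitable weights give every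
point `x` a value `fᵢ x` of weight at least `exp (-aᵢ)`, for some `i`. -/
lemma exists_weights_exp_neg_le [Nonempty Ω] {ι : Type*} {s : Finset ι} {lam a : ι → ℝ}
    (hlam : ∀ i ∈ s, 0 < lam i) (hs : s.Nonempty)
    {β : ι → Type*} [∀ i, Fintype (β i)] (f : ∀ i, Ω → β i)
    (hent : ∀ q ∈ stdSimplex ℝ Ω, ∑ i ∈ s, lam i * pushEntropy q (f i) ≤ ∑ i ∈ s, lam i * a i) :
    ∃ q ∈ stdSimplex ℝ Ω, ∀ x, ∃ i ∈ s, Real.exp (-a i) ≤ pushWeight q (f i) (f i x) := by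
  classical
  obtain ⟨q, hq, hmax⟩ := (isCompact_stdSimplex ℝ Ω).exists_isMaxOn
    ⟨_, single_mem_stdSimplex ℝ (Classical.arbitrary Ω)⟩
    (f := fun q => ∑ i ∈ s, lam i * pushEntropy q (f i))
    (continuous_finsetSum _ fun i _ =>
      continuous_const.mul (continuous_pushEntropy (f i))).continuousOn
  refine ⟨q, hq, fun x => ?_⟩
  by_contra! hcon
  -- For small `t` the moved weights still violate all the bounds.
  have hev : ∀ᶠ t in 𝓝[>] (0 : ℝ), ∀ i ∈ s,
      (1 - t) * pushWeight q (f i) (f i x) + t < Real.exp (-a i) := by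
    rw [Filter.eventually_all_finset]
    intro i hi
    have hc : ContinuousAt (fun t : ℝ => (1 - t) * pushWeight q (f i) (f i x) + t) 0 := by fun_prop
    exact (hc.eventually_lt continuousAt_const (by simpa using hcon i hi)).filter_mono
      nhdsWithin_le_nhds
  obtain ⟨t, ht, ht0, ht1⟩ := (hev.and (Ioo_mem_nhdsGT (zero_lt_one' ℝ))).exists
  have h1 := sum_neg_log_le_of_isMaxOn (fun i hi => (hlam i hi).le) f hq hmax x ht0 ht1
  have h2 : ∑ i ∈ s, lam i * a i <
      ∑ i ∈ s, lam i * -Real.log ((1 - t) * pushWeight q (f i) (f i x) + t) := by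
    refine Finset.sum_lt_sum_of_nonempty hs fun i hi => mul_lt_mul_of_pos_left ?_ (hlam i hi)
    have hpos : 0 < (1 - t) * pushWeight q (f i) (f i x) + t := by
      have := mul_nonneg (by linarith : 0 ≤ 1 - t) (pushWeight_nonneg hq.1 (f i) (f i x))
      linarith
    have := (Real.log_lt_iff_lt_exp hpos).2 (ht i hi)
    linarith
  linarith [hent q hq]

/-- A finite set on which `∑ λᵢ H(fᵢ) ≤ ∑ λᵢ aᵢ` for all weights splits into parts on which `fᵢ`
has at most `exp aᵢ` values. -/
lemma exists_splitting_of_pushEntropy_le {ι : Type*} {s : Finset ι} {lam a : ι → ℝ}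
    (hlam : ∀ i ∈ s, 0 < lam i) (hs : s.Nonempty)
    {β : ι → Type*} [∀ i, Fintype (β i)] (f : ∀ i, Ω → β i)
    (hent : ∀ q ∈ stdSimplex ℝ Ω, ∑ i ∈ s, lam i * pushEntropy q (f i) ≤ ∑ i ∈ s, lam i * a i) :
    ∃ c : Ω → ι, (∀ ω, c ω ∈ s) ∧
      ∀ i ∈ s, ((f i '' {ω | c ω = i}).ncard : ℝ) ≤ Real.exp (a i) := by
  classical
  rcases isEmpty_or_nonempty Ω with hΩ | hΩ
  · refine ⟨fun ω => hΩ.elim ω, fun ω => hΩ.elim ω, fun i _ => ?_⟩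
    rw [Set.eq_empty_of_isEmpty {ω | _}]
    simp [Real.exp_nonneg]
  obtain ⟨q, hq, h⟩ := exists_weights_exp_neg_le hlam hs f hent
  choose c hc hcq using h
  refine ⟨c, hc, fun i _ => ?_⟩
  set B := f i '' {ω | c ω = i}
  have h1 : ∑ b ∈ B.toFinset, Real.exp (-a i) ≤ ∑ b, pushWeight q (f i) b := by
    refine (Finset.sum_le_sum fun b hb => ?_).trans
      (Finset.sum_le_sum_of_subset_of_nonneg (Finset.subset_univ B.toFinset)
        fun b _ _ => pushWeight_nonneg hq.1 (f i) b)
    obtain ⟨ω, rfl, rfl⟩ := Set.mem_toFinset.1 hb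
    exact hcq ω
  rw [sum_pushWeight, hq.2, Finset.sum_const, nsmul_eq_mul, ← Set.ncard_eq_toFinset_card',
    Real.exp_neg] at h1
  rwa [← div_eq_mul_inv, div_le_one (Real.exp_pos _)] at h1

end

lemma ncard_image_subTuple_rangeFactorization {m : ℕ} {Ω : Type} {α : Fin m → Type}
    (ξ : ∀ i, Ω → α i) (I : Finset (Fin m)) (s : Set Ω) :
    (subTuple (fun i => rangeFactorization (ξ i)) I '' s).ncard = (subTuple ξ I '' s).ncard := by
  have : subTuple ξ I = (fun v (i : I) => (v i).1) ∘
      subTuple (fun i => rangeFactorization (ξ i)) I := rfl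
  rw [this, image_comp]
  refine (Set.ncard_image_of_injective _ fun v w h => ?_).symm
  funext i
  exact Subtype.ext (congrFun h i)

/-- The finite form of the statement about dimensions: logarithms of numbers of values take the
place of dimensions. -/
lemma EntropyInequality.exists_splitting {m : ℕ} {𝓘 𝓙 : Finset (Finset (Fin m))}
    {lam mu : Finset (Fin m) → ℝ≥0} (hE : EntropyInequality 𝓘 𝓙 lam mu) (h𝓘 : 𝓘.Nonempty)
    (hlam : ∀ I ∈ 𝓘, 0 < lam I) {Ω : Type} [Finite Ω] {α : Fin m → Type} (ξ : ∀ i, Ω → α i)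
    {a b : Finset (Fin m) → ℝ} (hb : ∀ J ∈ 𝓙, Real.log (range (subTuple ξ J)).ncard ≤ b J)
    (hab : ∑ J ∈ 𝓙, (mu J : ℝ) * b J ≤ ∑ I ∈ 𝓘, (lam I : ℝ) * a I) :
    ∃ c : Ω → Finset (Fin m), (∀ ω, c ω ∈ 𝓘) ∧
      ∀ I ∈ 𝓘, ((subTuple ξ I '' {ω | c ω = I}).ncard : ℝ) ≤ Real.exp (a I) := by
  classical
  have := Fintype.ofFinite Ω
  have : ∀ i, Fintype (range (ξ i)) := fun i => Fintype.ofFinite _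
  -- The alphabets may be infinite, so each variable is restricted to its finite range.
  let ξ' : ∀ i, Ω → range (ξ i) := fun i => rangeFactorization (ξ i)
  obtain ⟨c, hc, h⟩ := exists_splitting_of_pushEntropy_le (s := 𝓘) (lam := fun I => (lam I : ℝ))
    (a := a) (fun I hI => by exact_mod_cast hlam I hI) h𝓘 (fun I => subTuple ξ' I) fun q hq => by
      refine (hE.pushEntropy_le hq ξ').trans (le_trans ?_ hab)
      refine Finset.sum_le_sum fun J hJ => mul_le_mul_of_nonneg_left ?_ (NNReal.coe_nonneg _)
      refine (pushEntropy_le_log_ncard_range hq _).trans ?_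
      rw [← image_univ, ncard_image_subTuple_rangeFactorization, image_univ]
      exact hb J hJ
  refine ⟨c, hc, fun I hI => ?_⟩
  rw [← ncard_image_subTuple_rangeFactorization]
  exact h I hI

/-! ### Dyadic cubes -/

/-- The index of the half-open dyadic cube of side `2⁻ⁿ` that contains `x`. -/
noncomputable def cubeIndex {ι : Type*} (n : ℕ) (x : ι → ℝ) (i : ι) : ℤ := ⌊x i * 2 ^ n⌋

section
variable {ι : Type} [Fintype ι]

lemma ediam_cubeIndex_preimage_le (n : ℕ) (v : ι → ℤ) :
    Metric.ediam (cubeIndex n ⁻¹' {v}) ≤ ENNReal.ofReal ((2 ^ n)⁻¹) := by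
  refine Metric.ediam_le fun x hx y hy => ?_
  rw [edist_dist]
  refine ENNReal.ofReal_le_ofReal ((dist_pi_le_iff (by positivity)).2 fun i => ?_)
  have h : ⌊x i * 2 ^ n⌋ = ⌊y i * 2 ^ n⌋ :=
    (congrFun (hx : cubeIndex n x = v) i).trans (congrFun (hy : cubeIndex n y = v) i).symm
  have h1 := (Int.abs_sub_lt_one_of_floor_eq_floor h).le
  rw [← sub_mul, abs_mul, abs_of_pos (by positivity : (0 : ℝ) < 2 ^ n)] at h1
  rwa [Real.dist_eq, ← one_div, le_div_iff₀ (by positivity)]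

/-- A ball of radius `2⁻ⁿ` meets at most `3^d` dyadic cubes of side `2⁻ⁿ`. -/
lemma cubeIndex_image_finite_ncard_le {t : Set (ι → ℝ)} {n : ℕ} {r : ℝ≥0} (hr : (r : ℝ) = (2 ^ n)⁻¹)
    (hN : Metric.externalCoveringNumber r t ≠ ⊤) :
    (cubeIndex n '' t).Finite ∧ (cubeIndex n '' t).ncard ≤
      3 ^ Fintype.card ι * (Metric.externalCoveringNumber r t).toNat := by
  classical
  obtain ⟨⟨C, hC⟩, hcard⟩ : ∃ C : {C : Set (ι → ℝ) // Metric.IsCover r t C},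
      C.1.encard = Metric.externalCoveringNumber r t := by
    rw [Metric.externalCoveringNumber, iInf_subtype']
    have : Nonempty {C : Set (ι → ℝ) // Metric.IsCover r t C} := ⟨⟨t, by simp⟩⟩
    exact ENat.exists_eq_iInf _
  replace hcard : C.encard = _ := hcard
  have hfin : C.Finite := by rwa [← Set.encard_ne_top_iff, hcard]
  let D : Finset (ι → ℤ) := hfin.toFinset.biUnion fun c =>
    Fintype.piFinset fun i => Finset.Icc (cubeIndex n c i - 1) (cubeIndex n c i + 1)
  have hsub : cubeIndex n '' t ⊆ D := by
    rintro _ ⟨x, hx, rfl⟩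
    obtain ⟨c, hc, hxc⟩ := hC hx
    simp only [D, Finset.coe_biUnion, Set.mem_iUnion]
    refine ⟨c, by simpa using hc, ?_⟩
    simp only [Finset.mem_coe, Fintype.mem_piFinset, Finset.mem_Icc]
    intro i
    have h1 : dist (x i) (c i) ≤ (2 ^ n)⁻¹ := by
      rw [← hr]
      refine (dist_le_pi_dist x c i).trans ?_
      have : edist x c ≤ r := hxc
      rwa [edist_nndist, ENNReal.coe_le_coe, ← NNReal.coe_le_coe, coe_nndist] at this
    rw [Real.dist_eq, ← one_div, le_div_iff₀ (by positivity),
      ← abs_of_pos (by positivity : (0 : ℝ) < 2 ^ n), ← abs_mul, sub_mul, abs_le] at h1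
    constructor
    · rw [cubeIndex, cubeIndex, Int.le_floor]
      push_cast
      linarith [Int.floor_le (c i * 2 ^ n)]
    · rw [cubeIndex, cubeIndex, ← Int.floor_add_one]
      exact Int.floor_le_floor (by linarith)
  refine ⟨D.finite_toSet.subset hsub, ?_⟩
  refine (Set.ncard_le_ncard hsub D.finite_toSet).trans ?_
  rw [Set.ncard_coe_finset]
  refine Finset.card_biUnion_le.trans ?_
  have : ∀ c : ι → ℝ, (Fintype.piFinset fun i =>
      Finset.Icc (cubeIndex n c i - 1) (cubeIndex n c i + 1)).card = 3 ^ Fintype.card ι := by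
    intro c
    rw [Fintype.card_piFinset]
    simp only [Int.card_Icc]
    rw [Finset.prod_congr rfl (g := fun _ => 3) fun i _ => by ring_nf; rfl]
    simp
  rw [Finset.sum_congr rfl fun c _ => this c, Finset.sum_const, smul_eq_mul, mul_comm,
    ← hcard, ← Set.ncard_def, Set.ncard_eq_toFinset_card _ hfin]

/-- Upper box dimension bounds the numbers of dyadic cubes at all small scales. -/
lemma eventually_ncard_cubeIndex_image_le {t : Set (ι → ℝ)} {β : ℝ≥0} (h : upperBoxDim t < β) :
    ∀ᶠ n : ℕ in atTop, (cubeIndex n '' t).Finite ∧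
      ((cubeIndex n '' t).ncard : ℝ) ≤ 3 ^ Fintype.card ι * Real.exp (n * (β * Real.log 2)) := by
  have hlim : limsup (fun r : ℝ≥0 => ENNReal.log ((Metric.externalCoveringNumber r t : ℕ∞) : ℝ≥0∞) /
      ((Real.log (1 / (r : ℝ)) : ℝ) : EReal)) (𝓝[>] 0) < ((β : ℝ) : EReal) := by
    by_contra! hcon
    have := EReal.toENNReal_le_toENNReal hcon
    rw [EReal.toENNReal_of_ne_top (EReal.coe_ne_top _), EReal.toReal_coe,
      ENNReal.ofReal_coe_nnreal] at this
    exact absurd h (not_lt.2 this)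
  have hev := eventually_lt_of_limsup_lt hlim
  have htend : Tendsto (fun n : ℕ => ((2 : ℝ≥0) ^ n)⁻¹) atTop (𝓝[>] 0) := by
    refine tendsto_nhdsWithin_iff.2 ⟨?_, Eventually.of_forall fun n => ?_⟩
    · simp_rw [← inv_pow]
      exact tendsto_pow_atTop_nhds_zero_of_lt_one (by simp)
        (by rw [← NNReal.coe_lt_coe]; push_cast; norm_num)
    · simp only [mem_Ioi]; positivity
  filter_upwards [htend.eventually hev, eventually_gt_atTop 0] with n hn hn0
  set r : ℝ≥0 := ((2 : ℝ≥0) ^ n)⁻¹ with hr_def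
  have hr : (r : ℝ) = (2 ^ n)⁻¹ := by rw [hr_def]; push_cast; rfl
  have hlog : Real.log (1 / (r : ℝ)) = n * Real.log 2 := by rw [hr]; simp
  have hL : 0 < (n : ℝ) * Real.log 2 := by
    have : (0 : ℝ) < n := by exact_mod_cast hn0
    exact mul_pos this (Real.log_pos one_lt_two)
  rw [hlog, EReal.div_lt_iff (by exact_mod_cast hL) (EReal.coe_ne_top _), ← EReal.coe_mul] at hn
  have hN : Metric.externalCoveringNumber r t ≠ ⊤ := by
    intro htop
    rw [htop] at hn
    simp at hn
  obtain ⟨h1, h2⟩ := cubeIndex_image_finite_ncard_le hr hN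
  refine ⟨h1, ?_⟩
  have h3 : ((Metric.externalCoveringNumber r t).toNat : ℝ) ≤
      Real.exp (n * (β * Real.log 2)) := by
    obtain ⟨N, hN'⟩ := ENat.ne_top_iff_exists.1 hN
    rw [← hN'] at hn ⊢
    rcases Nat.eq_zero_or_pos N with rfl | hNpos
    · simp [Real.exp_nonneg]
    · have hNr : (0 : ℝ) < N := by exact_mod_cast hNpos
      have : (((N : ℕ∞) : ℝ≥0∞)) = ENNReal.ofReal (N : ℝ) := by simp
      rw [this, ENNReal.log_ofReal_of_pos hNr, EReal.coe_lt_coe_iff] at hn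
      simp only [ENat.toNat_natCast]
      rw [← Real.log_le_iff_le_exp hNr]
      linarith
  calc ((cubeIndex n '' t).ncard : ℝ)
      ≤ ((3 ^ Fintype.card ι * (Metric.externalCoveringNumber r t).toNat : ℕ) : ℝ) := by
        exact_mod_cast h2
    _ ≤ _ := by push_cast; gcongr

/-- A set whose points lie, for infinitely many `n`, in one of `2 ^ (n α)` given dyadic cubes of
side `2⁻ⁿ` has Hausdorff dimension at most `α`. -/
lemma dimH_le_of_frequently_cubeIndex_mem {T : Set (ι → ℝ)} {α : ℝ≥0} (B : ℕ → Finset (ι → ℤ))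
    (hB : ∀ᶠ n in atTop, ((B n).card : ℝ) ≤ Real.exp (n * (α * Real.log 2)))
    (hT : ∀ x ∈ T, ∃ᶠ n in atTop, cubeIndex n x ∈ B n) : dimH T ≤ α := by
  refine le_of_forall_gt_imp_ge_of_dense fun d' hd' => ?_
  rcases eq_or_ne d' ⊤ with rfl | htop
  · exact le_top
  lift d' to ℝ≥0 using htop
  rw [ENNReal.coe_lt_coe] at hd'
  have hd : (α : ℝ) < d' := by exact_mod_cast hd'
  refine dimH_le_of_hausdorffMeasure_ne_top ?_
  have hlog := Real.log_pos one_lt_two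
  set ρ : ℝ := Real.exp (-((d' - α) * Real.log 2))
  have hρ0 : 0 ≤ ρ := Real.exp_nonneg _
  have hρ1 : ρ < 1 := by
    rw [Real.exp_lt_one_iff]
    nlinarith
  obtain ⟨n₀, hn₀⟩ := eventually_atTop.1 hB
  have hr : Tendsto (fun N : ℕ => ENNReal.ofReal ((2 ^ N)⁻¹ : ℝ)) atTop (𝓝 0) := by
    rw [← ENNReal.ofReal_zero]
    refine ENNReal.tendsto_ofReal ?_
    simp_rw [← inv_pow]
    exact tendsto_pow_atTop_nhds_zero_of_lt_one (by norm_num) (by norm_num)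
  -- For every `N`, the chosen cubes of all levels `N + k` cover `T`.
  have hmain := Measure.hausdorffMeasure_le_liminf_tsum (d' : ℝ) T
    (ι := fun N : ℕ => Σ k : ℕ, B (N + k)) (l := atTop) (fun N => ENNReal.ofReal ((2 ^ N)⁻¹ : ℝ)) hr
    (fun N v => cubeIndex (N + v.1) ⁻¹' {v.2.1})
    (Eventually.of_forall fun N v => (ediam_cubeIndex_preimage_le _ _).trans
      (ENNReal.ofReal_le_ofReal (inv_anti₀ (by positivity)
        (pow_le_pow_right₀ one_le_two (Nat.le_add_right _ _)))))
    (Eventually.of_forall fun N x hx => by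
      obtain ⟨n, hn, hxn⟩ := frequently_atTop.1 (hT x hx) N
      obtain ⟨k, rfl⟩ := Nat.exists_eq_add_of_le hn
      exact mem_iUnion.2 ⟨⟨k, ⟨_, hxn⟩⟩, rfl⟩)
  have hbound : ∀ N ≥ n₀, ∑' v : (Σ k : ℕ, B (N + k)),
      Metric.ediam (cubeIndex (N + v.1) ⁻¹' {v.2.1} : Set (ι → ℝ)) ^ (d' : ℝ) ≤
        ENNReal.ofReal (∑' k : ℕ, ρ ^ k) := by
    intro N hN
    rw [ENNReal.tsum_sigma', ENNReal.ofReal_tsum_of_nonneg (fun k => pow_nonneg hρ0 k)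
      (summable_geometric_of_lt_one hρ0 hρ1)]
    refine ENNReal.tsum_le_tsum fun k => ?_
    have h1 : ∀ v : B (N + k), Metric.ediam (cubeIndex (N + k) ⁻¹' {v.1} : Set (ι → ℝ)) ^ (d' : ℝ) ≤
        ENNReal.ofReal (Real.exp (-((N + k : ℕ) * (d' * Real.log 2)))) := fun v => by
      refine (ENNReal.rpow_le_rpow (ediam_cubeIndex_preimage_le _ _) (by positivity)).trans_eq ?_
      rw [ENNReal.ofReal_rpow_of_pos (by positivity), Real.rpow_def_of_pos (by positivity),
        Real.log_inv, Real.log_pow]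
      congr 2
      ring
    refine (ENNReal.tsum_le_tsum h1).trans ?_
    rw [tsum_fintype, Finset.sum_const, Finset.card_univ, Fintype.card_coe, nsmul_eq_mul,
      ← ENNReal.ofReal_natCast, ← ENNReal.ofReal_mul (by positivity)]
    refine ENNReal.ofReal_le_ofReal ?_
    calc _ ≤ Real.exp ((N + k : ℕ) * (α * Real.log 2)) *
          Real.exp (-((N + k : ℕ) * (d' * Real.log 2))) := by
          gcongr
          exact hn₀ (N + k) (by omega)
      _ = ρ ^ (N + k) := by
          rw [← Real.exp_add, ← Real.exp_nat_mul]
          congr 1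
          ring
      _ ≤ ρ ^ k := pow_le_pow_of_le_one hρ0 hρ1.le (Nat.le_add_left _ _)
  refine ne_top_of_le_ne_top (b := ENNReal.ofReal (∑' k : ℕ, ρ ^ k)) ENNReal.ofReal_ne_top
    (hmain.trans ?_)
  refine liminf_le_of_frequently_le' (Eventually.frequently ?_)
  filter_upwards [eventually_ge_atTop n₀] with N hN using hbound N hN

end

section

/-! ### From the inequality for entropies to the statement about dimensions -/

variable {m : ℕ} {𝓘 𝓙 : Finset (Finset (Fin m))} {lam mu : Finset (Fin m) → ℝ≥0}

lemma proj_iUnion {ι : Sort*} (I : Finset (Fin m)) (S : ι → Set (Fin m → ℝ)) :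
    proj I (⋃ k, S k) = ⋃ k, proj I (S k) :=
  image_iUnion

lemma proj_mono (I : Finset (Fin m)) {S T : Set (Fin m → ℝ)} (h : S ⊆ T) : proj I S ⊆ proj I T :=
  image_mono h

/-- The splitting of a set whose projections have controlled box dimensions: at every dyadic scale
the finite set of cubes that meet `S` is split, and a point goes to a part that it meets at
infinitely many scales. -/
lemma EntropyInequality.exists_splitting_of_upperBoxDim_lt (hE : EntropyInequality 𝓘 𝓙 lam mu)
    (h𝓘 : 𝓘.Nonempty) (hlam : ∀ I ∈ 𝓘, 0 < lam I) {S : Set (Fin m → ℝ)}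
    (hS : ∀ n, (cubeIndex n '' S).Finite) {t : ∀ J : Finset (Fin m), Set (J → ℝ)}
    {d a : Finset (Fin m) → ℝ≥0} (hSt : ∀ J ∈ 𝓙, proj J S ⊆ t J)
    (ht : ∀ J ∈ 𝓙, upperBoxDim (t J) < d J)
    (hda : ∑ J ∈ 𝓙, (mu J : ℝ) * d J < ∑ I ∈ 𝓘, (lam I : ℝ) * a I) :
    ∃ T : Finset (Fin m) → Set (Fin m → ℝ),
      S = ⋃ I ∈ 𝓘, T I ∧ ∀ I ∈ 𝓘, dimH (proj I (T I)) ≤ a I := by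
  classical
  have hlog := Real.log_pos one_lt_two
  -- The projections of the level-`n` cubes satisfy the bounds that the finite splitting needs.
  have hev : ∀ᶠ n : ℕ in atTop, ∃ c : (Fin m → ℤ) → Finset (Fin m), (∀ v, c v ∈ 𝓘) ∧
      ∀ I ∈ 𝓘, (((fun v (i : I) => v i) '' {v ∈ cubeIndex n '' S | c v = I}).ncard : ℝ) ≤
        Real.exp (n * (a I * Real.log 2)) := by
    have h1 : ∀ᶠ n : ℕ in atTop, ∀ J ∈ 𝓙, (cubeIndex n '' t J).Finite ∧
        ((cubeIndex n '' t J).ncard : ℝ) ≤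
          3 ^ Fintype.card J * Real.exp (n * (d J * Real.log 2)) :=
      (Filter.eventually_all_finset _).2 fun J hJ => eventually_ncard_cubeIndex_image_le (ht J hJ)
    have h2 : ∀ᶠ n : ℕ in atTop, ∑ J ∈ 𝓙, (mu J : ℝ) * (Fintype.card J * Real.log 3) ≤
        n * ((∑ I ∈ 𝓘, (lam I : ℝ) * a I - ∑ J ∈ 𝓙, (mu J : ℝ) * d J) * Real.log 2) :=
      (tendsto_natCast_atTop_atTop.atTop_mul_const
        (mul_pos (sub_pos.2 hda) hlog)).eventually_ge_atTop _
    filter_upwards [h1, h2] with n h1 h2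
    have hfin : Finite (cubeIndex n '' S) := hS n
    obtain ⟨c, hc, hcard⟩ := hE.exists_splitting h𝓘 hlam (Ω := cubeIndex n '' S)
      (fun i v => v.1 i) (b := fun J => Fintype.card J * Real.log 3 + n * (d J * Real.log 2))
      (a := fun I => n * (a I * Real.log 2))
      (fun J hJ => by
        have hsub : range (subTuple (fun i (v : cubeIndex n '' S) => v.1 i) J) ⊆
            cubeIndex n '' t J := by
          rintro _ ⟨⟨_, x, hx, rfl⟩, rfl⟩
          exact ⟨_, hSt J hJ ⟨x, hx, rfl⟩, rfl⟩
        have hle := (Nat.cast_le (α := ℝ)).2 (Set.ncard_le_ncard hsub (h1 J hJ).1)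
        rcases Nat.eq_zero_or_pos
          (range (subTuple (fun i (v : cubeIndex n '' S) => v.1 i) J)).ncard with h0 | h0
        · rw [h0, Nat.cast_zero, Real.log_zero]
          positivity
        · rw [Real.log_le_iff_le_exp (by exact_mod_cast h0), Real.exp_add, ← Real.log_pow,
            Real.exp_log (by positivity)]
          exact hle.trans (h1 J hJ).2)
      (by
        simp only [mul_add, Finset.sum_add_distrib]
        have e1 : ∑ J ∈ 𝓙, (mu J : ℝ) * (n * (d J * Real.log 2)) =
            n * ((∑ J ∈ 𝓙, (mu J : ℝ) * d J) * Real.log 2) := by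
          rw [Finset.sum_mul, Finset.mul_sum]
          exact Finset.sum_congr rfl fun _ _ => by ring
        have e2 : ∑ I ∈ 𝓘, (lam I : ℝ) * (n * (a I * Real.log 2)) =
            n * ((∑ I ∈ 𝓘, (lam I : ℝ) * a I) * Real.log 2) := by
          rw [Finset.sum_mul, Finset.mul_sum]
          exact Finset.sum_congr rfl fun _ _ => by ring
        rw [e1, e2]
        rw [sub_mul, mul_sub] at h2
        linarith)
    obtain ⟨I₀, hI₀⟩ := h𝓘
    refine ⟨fun v => if hv : v ∈ cubeIndex n '' S then c ⟨v, hv⟩ else I₀, fun v => ?_,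
      fun I hI => ?_⟩
    · dsimp only
      split_ifs
      exacts [hc _, hI₀]
    · refine le_trans (Nat.cast_le.2 (Set.ncard_le_ncard ?_ (Set.toFinite _))) (hcard I hI)
      rintro _ ⟨v, ⟨hv, hvI⟩, rfl⟩
      refine ⟨⟨v, hv⟩, ?_, rfl⟩
      simpa [hv] using hvI
  obtain ⟨n₀, hn₀⟩ := eventually_atTop.1 hev
  choose! c hc hcard using hn₀
  refine ⟨fun I => {x ∈ S | ∃ᶠ n in atTop, c n (cubeIndex n x) = I}, ?_, fun I hI => ?_⟩
  · refine Subset.antisymm (fun x hx => ?_) (iUnion₂_subset fun I _ => sep_subset _ _)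
    by_contra hcon
    simp only [mem_iUnion, mem_ofPred_eq, not_exists, hx, true_and, not_frequently] at hcon
    have := (Filter.eventually_all_finset 𝓘).2 hcon
    obtain ⟨n, hn, hn0⟩ := (this.and (eventually_ge_atTop n₀)).exists
    exact hn _ (hc n hn0 _) rfl
  · have hBfin : ∀ n, ((fun v (i : I) => v i) '' {v ∈ cubeIndex n '' S | c n v = I}).Finite :=
      fun n => ((hS n).subset (sep_subset _ _)).image _
    refine dimH_le_of_frequently_cubeIndex_mem (fun n => (hBfin n).toFinset) ?_ ?_
    · filter_upwards [eventually_ge_atTop n₀] with n hn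
      rw [← Set.ncard_eq_toFinset_card _ (hBfin n)]
      exact hcard n hn I hI
    · rintro _ ⟨x, ⟨hxS, hx⟩, rfl⟩
      refine hx.mono fun n hn => ?_
      rw [Set.Finite.mem_toFinset]
      exact ⟨cubeIndex n x, ⟨mem_image_of_mem _ hxS, hn⟩, rfl⟩

lemma finite_cubeIndex_image_of_abs_le {S : Set (Fin m → ℝ)} {b : ℝ} (h : ∀ x ∈ S, ∀ i, |x i| ≤ b)
    (n : ℕ) : (cubeIndex n '' S).Finite := by
  refine (Set.Finite.pi' fun _ : Fin m => Set.finite_Icc ⌊-b * 2 ^ n⌋ ⌊b * 2 ^ n⌋).subset ?_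
  rintro _ ⟨x, hx, rfl⟩ i
  have := abs_le.1 (h x hx i)
  exact ⟨Int.floor_le_floor (by gcongr; exact this.1), Int.floor_le_floor (by gcongr; exact this.2)⟩

lemma exists_cover_of_packingDim_lt {X : Type} [PseudoEMetricSpace X] {s : Set X} {d : ℝ≥0∞}
    (h : packingDim s < d) : ∃ t : ℕ → Set X, s ⊆ ⋃ k, t k ∧ ∀ k, upperBoxDim (t k) < d := by
  simp only [packingDim, iInf_lt_iff] at h
  obtain ⟨t, ht, h⟩ := h
  exact ⟨t, ht, fun k => (le_iSup (fun k => upperBoxDim (t k)) k).trans_lt h⟩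

/-- The splitting up to an arbitrarily small loss `δ` in the dimensions. -/
lemma EntropyInequality.exists_splitting_add (hE : EntropyInequality 𝓘 𝓙 lam mu)
    (h𝓘 : 𝓘.Nonempty) (hlam : ∀ I ∈ 𝓘, 0 < lam I) (hmu : ∀ J ∈ 𝓙, 0 < mu J)
    {S : Set (Fin m → ℝ)} {a : Finset (Fin m) → ℝ≥0}
    (hS : ∑ J ∈ 𝓙, (mu J : ℝ≥0∞) * packingDim (proj J S) ≤
      ∑ I ∈ 𝓘, (lam I : ℝ≥0∞) * (a I : ℝ≥0∞)) {δ : ℝ≥0} (hδ : 0 < δ) :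
    ∃ T : Finset (Fin m) → Set (Fin m → ℝ),
      S = ⋃ I ∈ 𝓘, T I ∧ ∀ I ∈ 𝓘, dimH (proj I (T I)) ≤ (a I + δ : ℝ≥0) := by
  have hrhs : ∑ I ∈ 𝓘, (lam I : ℝ≥0∞) * (a I : ℝ≥0∞) = ((∑ I ∈ 𝓘, lam I * a I : ℝ≥0) : ℝ≥0∞) := by
    push_cast; rfl
  have hpd : ∀ J ∈ 𝓙, packingDim (proj J S) ≠ ⊤ := by
    intro J hJ htop
    have h1 := (Finset.single_le_sum
      (f := fun J => (mu J : ℝ≥0∞) * packingDim (proj J S)) (fun _ _ => zero_le) hJ).trans hS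
    rw [htop, ENNReal.mul_top (by exact_mod_cast (hmu J hJ).ne'), hrhs] at h1
    exact ENNReal.coe_ne_top (top_le_iff.1 h1)
  have hreal : ∑ J ∈ 𝓙, mu J * (packingDim (proj J S)).toNNReal ≤ ∑ I ∈ 𝓘, lam I * a I := by
    rw [← ENNReal.coe_le_coe, ← hrhs]
    refine le_trans (le_of_eq ?_) hS
    push_cast
    exact Finset.sum_congr rfl fun J hJ => by rw [ENNReal.coe_toNNReal (hpd J hJ)]
  have hL : 0 < ∑ I ∈ 𝓘, lam I := Finset.sum_pos hlam h𝓘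
  -- `ε` is so small that `ε ∑ μ_J < δ ∑ λ_I`.
  obtain ⟨ε, hε, hεδ⟩ : ∃ ε : ℝ≥0, 0 < ε ∧ ε * ∑ J ∈ 𝓙, mu J < δ * ∑ I ∈ 𝓘, lam I := by
    refine ⟨δ * (∑ I ∈ 𝓘, lam I) / (∑ J ∈ 𝓙, mu J + 1), by positivity, ?_⟩
    rw [div_mul_eq_mul_div, div_lt_iff₀ (by positivity)]
    exact mul_lt_mul_of_pos_left (lt_add_one _) (by positivity)
  have hcov : ∀ J : Finset (Fin m), ∃ t : ℕ → Set (J → ℝ), J ∈ 𝓙 → proj J S ⊆ ⋃ k, t k ∧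
      ∀ k, upperBoxDim (t k) < ((packingDim (proj J S)).toNNReal + ε : ℝ≥0) := by
    intro J
    by_cases hJ : J ∈ 𝓙
    · obtain ⟨t, h1, h2⟩ := exists_cover_of_packingDim_lt (s := proj J S)
        (d := ((packingDim (proj J S)).toNNReal + ε : ℝ≥0)) (by
          rw [ENNReal.coe_add, ENNReal.coe_toNNReal (hpd J hJ)]
          exact ENNReal.lt_add_right (hpd J hJ) (by exact_mod_cast hε.ne'))
      exact ⟨t, fun _ => ⟨h1, h2⟩⟩
    · exact ⟨fun _ => ∅, fun h => absurd h hJ⟩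
  choose t ht using hcov
  -- Cut `S` into bounded pieces whose projections lie in single members of the covers.
  let P : (Finset (Fin m) → ℕ) × ℕ → Set (Fin m → ℝ) := fun k =>
    {x ∈ S | (∀ J ∈ 𝓙, (fun i : J => x i) ∈ t J (k.1 J)) ∧ ∀ i, |x i| ≤ k.2}
  have hP : ∀ k, ∃ T : Finset (Fin m) → Set (Fin m → ℝ),
      P k = ⋃ I ∈ 𝓘, T I ∧ ∀ I ∈ 𝓘, dimH (proj I (T I)) ≤ (a I + δ : ℝ≥0) := by
    intro k
    refine hE.exists_splitting_of_upperBoxDim_lt h𝓘 hlam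
      (finite_cubeIndex_image_of_abs_le fun x hx => hx.2.2) (t := fun J => t J (k.1 J))
      (d := fun J => (packingDim (proj J S)).toNNReal + ε) (a := fun I => a I + δ) ?_
      (fun J hJ => (ht J hJ).2 _) ?_
    · rintro J hJ _ ⟨x, hx, rfl⟩
      exact hx.2.1 J hJ
    · have : ∑ J ∈ 𝓙, mu J * ((packingDim (proj J S)).toNNReal + ε) <
          ∑ I ∈ 𝓘, lam I * (a I + δ) := by
        simp only [mul_add, Finset.sum_add_distrib, ← Finset.sum_mul]
        rw [mul_comm _ ε, mul_comm _ δ]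
        exact add_lt_add_of_le_of_lt hreal hεδ
      exact_mod_cast this
  choose T hT hTd using hP
  refine ⟨fun I => ⋃ k, T k I, ?_, fun I hI => ?_⟩
  · have hSP : S = ⋃ k, P k := by
      refine Subset.antisymm (fun x hx => ?_) (iUnion_subset fun k => sep_subset _ _)
      have h1 : ∀ J, ∃ k, J ∈ 𝓙 → (fun i : J => x i) ∈ t J k := fun J => by
        by_cases hJ : J ∈ 𝓙
        · obtain ⟨k, hk⟩ := mem_iUnion.1 ((ht J hJ).1 ⟨x, hx, rfl⟩)
          exact ⟨k, fun _ => hk⟩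
        · exact ⟨0, fun h => absurd h hJ⟩
      choose k hk using h1
      obtain ⟨b, hb⟩ := exists_nat_ge ‖x‖
      exact mem_iUnion.2 ⟨(k, b), hx, hk, fun i => (norm_le_pi_norm x i).trans hb⟩
    rw [hSP, iUnion_congr hT, iUnion_comm]
    refine iUnion_congr fun I => iUnion_comm _
  · rw [proj_iUnion, dimH_iUnion]
    exact iSup_le fun k => hTd k I hI

/-- The inequality for entropies implies the statement about dimensions. -/
lemma EntropyInequality.dimensionStatement (hE : EntropyInequality 𝓘 𝓙 lam mu)
    (h𝓘 : 𝓘.Nonempty) (hlam : ∀ I ∈ 𝓘, 0 < lam I) (hmu : ∀ J ∈ 𝓙, 0 < mu J) :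
    DimensionStatement 𝓘 𝓙 lam mu := by
  intro S a hS
  have h : ∀ j : ℕ, ∃ T : Finset (Fin m) → Set (Fin m → ℝ), S = ⋃ I ∈ 𝓘, T I ∧
      ∀ I ∈ 𝓘, dimH (proj I (T I)) ≤ (a I + 1 / (j + 1) : ℝ≥0) := fun j =>
    hE.exists_splitting_add h𝓘 hlam hmu hS (by positivity)
  choose T hT hTd using h
  -- Each point belongs, for some `I`, to infinitely many of the approximate parts for `I`.
  refine ⟨fun I => {x | ∃ᶠ j in atTop, x ∈ T j I}, Subset.antisymm (fun x hx => ?_)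
    (iUnion₂_subset fun I hI x hx => ?_), fun I hI => ?_⟩
  · by_contra hcon
    simp only [mem_iUnion, mem_ofPred_eq, not_exists, not_frequently] at hcon
    obtain ⟨j, hj⟩ := ((Filter.eventually_all_finset 𝓘).2 hcon).exists
    rw [hT j] at hx
    obtain ⟨I, hI, hxI⟩ := mem_iUnion₂.1 hx
    exact hj I hI hxI
  · obtain ⟨j, hj⟩ := Frequently.exists hx
    rw [hT j]
    exact mem_iUnion₂.2 ⟨I, hI, hj⟩
  · have hle : ∀ j₀ : ℕ, dimH (proj I {x | ∃ᶠ j in atTop, x ∈ T j I}) ≤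
        (a I + 1 / (j₀ + 1) : ℝ≥0) := by
      intro j₀
      have hsub : {x | ∃ᶠ j in atTop, x ∈ T j I} ⊆ ⋃ k, T (j₀ + k) I := fun x hx => by
        obtain ⟨j, hj, hxj⟩ := frequently_atTop.1 hx j₀
        obtain ⟨k, rfl⟩ := Nat.exists_eq_add_of_le hj
        exact mem_iUnion.2 ⟨k, hxj⟩
      refine (dimH_mono (proj_mono I hsub)).trans ?_
      rw [proj_iUnion, dimH_iUnion]
      refine iSup_le fun k => (hTd _ I hI).trans ?_
      rw [ENNReal.coe_le_coe]
      gcongr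
      exact Nat.le_add_right _ _
    have hlim : Tendsto (fun j : ℕ => ((a I + 1 / (j + 1) : ℝ≥0) : ℝ≥0∞)) atTop (𝓝 (a I)) := by
      rw [ENNReal.tendsto_coe]
      simpa using tendsto_const_nhds.add (NNReal.tendsto_coe.1
        (by push_cast; exact tendsto_one_div_add_atTop_nhds_zero_nat (𝕜 := ℝ)) :
          Tendsto (fun j : ℕ => (1 / (j + 1) : ℝ≥0)) atTop (𝓝 0))
    exact ge_of_tendsto' hlim hle

end

/-! ### Entropies of coset variables -/

section
variable {m : ℕ} {G : Type} [Group G] (H : Fin m → Subgroup G) (I : Finset (Fin m))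

lemma subTuple_cosetTuple_eq_iff {g h : G} :
    subTuple (cosetTuple H) I g = subTuple (cosetTuple H) I h ↔ g⁻¹ * h ∈ ⨅ i : I, H i := by
  simp only [funext_iff, subTuple, cosetTuple, Subgroup.mem_iInf]
  exact forall_congr' fun i => QuotientGroup.eq

lemma ncard_fiber_subTuple_cosetTuple (g : G) :
    (subTuple (cosetTuple H) I ⁻¹' {subTuple (cosetTuple H) I g}).ncard =
      Nat.card (⨅ i : I, H i : Subgroup G) := by
  have : subTuple (cosetTuple H) I ⁻¹' {subTuple (cosetTuple H) I g} =
      (g * ·) '' ((⨅ i : I, H i : Subgroup G) : Set G) := by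
    ext h
    rw [mem_preimage, mem_singleton_iff, eq_comm, subTuple_cosetTuple_eq_iff, mem_image]
    exact ⟨fun hh => ⟨_, hh, by simp⟩, by rintro ⟨k, hk, rfl⟩; simpa using hk⟩
  rw [this, Set.ncard_image_of_injective _ (mul_right_injective g)]
  rfl

lemma ncard_range_subTuple_cosetTuple :
    (range (subTuple (cosetTuple H) I)).ncard = (⨅ i : I, H i : Subgroup G).index := by
  have : subTuple (cosetTuple H) I =
      Subgroup.quotientiInfEmbedding (fun i : I => H i) ∘ QuotientGroup.mk := rfl
  rw [this, QuotientGroup.mk_surjective.range_comp, ← image_univ,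
    Set.ncard_image_of_injective _ (Function.Embedding.injective _), Set.ncard_univ]
  rfl

lemma uniformOn_real_fiber_subTuple_cosetTuple [Finite G] [MeasurableSpace G]
    [MeasurableSingletonClass G] (g : G) :
    (ProbabilityTheory.uniformOn (univ : Set G)).real
      (subTuple (cosetTuple H) I ⁻¹' {subTuple (cosetTuple H) I g}) =
        (((range (subTuple (cosetTuple H) I)).ncard : ℝ))⁻¹ := by
  have := Fintype.ofFinite G
  have hK : (Nat.card (⨅ i : I, H i : Subgroup G) : ℝ) ≠ 0 := by exact_mod_cast Nat.card_pos.ne'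
  rw [Measure.real, ProbabilityTheory.uniformOn_univ, Measure.count_apply (Set.toFinite _).measurableSet,
    ← (Set.toFinite _).cast_ncard_eq, ncard_fiber_subTuple_cosetTuple,
    ncard_range_subTuple_cosetTuple, ENNReal.toReal_div]
  simp only [ENat.toENNReal_coe, ENNReal.toReal_natCast]
  rw [← Nat.card_eq_fintype_card, ← Subgroup.card_mul_index (⨅ i : I, H i : Subgroup G)]
  push_cast
  rw [div_mul_cancel_left₀ hK]

/-- The coset variables are uniformly distributed on their range. -/
lemma cosetEntropy_eq_log_ncard [Finite G] :
    cosetEntropy H I = Real.log (range (subTuple (cosetTuple H) I)).ncard := by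
  classical
  let _ : MeasurableSpace G := ⊤
  have hfin : Fintype ((i : I) → G ⧸ H i) := Fintype.ofFinite _
  have hc : ((range (subTuple (cosetTuple H) I)).ncard : ℝ) ≠ 0 := by
    exact_mod_cast ((Set.ncard_pos (Set.toFinite _)).2 (range_nonempty _)).ne'
  set c : ℝ := ((range (subTuple (cosetTuple H) I)).ncard : ℝ) with hc_def
  have h : ∀ b, Real.negMulLog ((ProbabilityTheory.uniformOn (univ : Set G)).real
      (subTuple (cosetTuple H) I ⁻¹' {b})) =
        if b ∈ range (subTuple (cosetTuple H) I) then c⁻¹ * Real.log c else 0 := by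
    intro b
    split_ifs with hb
    · obtain ⟨g, rfl⟩ := hb
      rw [uniformOn_real_fiber_subTuple_cosetTuple, Real.negMulLog, Real.log_inv, neg_mul_neg]
    · rw [Set.preimage_singleton_eq_empty.2 hb]
      simp
  rw [cosetEntropy, shannonEntropy, finsum_eq_sum_of_fintype, Finset.sum_congr rfl fun b _ => h b,
    ← Finset.sum_filter, Finset.sum_const, ← Set.ncard_coe_finset]
  simp only [Finset.coe_filter, Finset.mem_univ, true_and, Set.ofPred_mem_eq, nsmul_eq_mul]
  rw [← hc_def, ← mul_assoc, mul_inv_cancel₀ hc, one_mul]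

end

section
open scoped Nat

/-! ### Groups of label-preserving permutations -/

/-- The subgroup of the permutations of `Y` that preserve the label `ℓ`. -/
def labelSubgroup {Y β : Type*} (ℓ : Y → β) : Subgroup (Equiv.Perm Y) where
  carrier := {g | ℓ ∘ g = ℓ}
  mul_mem' {g h} hg hh := by
    change ℓ ∘ (g ∘ h) = ℓ
    rw [← Function.comp_assoc, (hg : ℓ ∘ g = ℓ), (hh : ℓ ∘ h = ℓ)]
  one_mem' := rfl
  inv_mem' {g} hg := by
    change ℓ ∘ g.symm = ℓ
    conv_lhs => rw [← (hg : ℓ ∘ g = ℓ), Function.comp_assoc, Equiv.self_comp_symm, Function.comp_id]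

/-- The coset entropies are logarithms of multinomial coefficients. -/
lemma cosetEntropy_labelSubgroup {m : ℕ} {Y : Type} [Fintype Y] {β : Fin m → Type}
    [∀ i, Fintype (β i)] (ℓ : ∀ i, Y → β i) (I : Finset (Fin m)) :
    cosetEntropy (fun i => labelSubgroup (ℓ i)) I =
      Real.log (Fintype.card Y)! -
        ∑ b, Real.log ((subTuple ℓ I ⁻¹' {b}).ncard)! := by
  classical
  have hcard : Nat.card (⨅ i : I, labelSubgroup (ℓ i) : Subgroup (Equiv.Perm Y)) =
      ∏ b, ((subTuple ℓ I ⁻¹' {b}).ncard)! := by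
    have h := DomMulAct.stabilizer_card (subTuple ℓ I)
    rw [← Nat.card_eq_fintype_card] at h
    rw [Nat.card_congr (Equiv.subtypeEquivRight fun g => ?_), h]
    · refine Finset.prod_congr rfl fun b _ => ?_
      rw [← Nat.card_eq_fintype_card]
      rfl
    · rw [Subgroup.mem_iInf]
      simp only [labelSubgroup, Subgroup.mem_mk, funext_iff, subTuple, Function.comp_apply]
      exact forall_comm
  have hidx := Subgroup.card_mul_index (⨅ i : I, labelSubgroup (ℓ i) : Subgroup (Equiv.Perm Y))
  rw [hcard, Nat.card_eq_fintype_card, Fintype.card_perm] at hidx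
  have hlog := congrArg (fun k : ℕ => Real.log k) hidx
  have hprod : ((∏ b, ((subTuple ℓ I ⁻¹' {b}).ncard)! : ℕ) : ℝ) ≠ 0 := by
    exact_mod_cast (Finset.prod_pos fun b _ => Nat.factorial_pos _).ne'
  simp only [Nat.cast_mul] at hlog
  rw [Real.log_mul hprod (by exact_mod_cast Subgroup.index_ne_zero_of_finite), Nat.cast_prod,
    Real.log_prod (fun b _ => by exact_mod_cast (Nat.factorial_ne_zero _))] at hlog
  rw [cosetEntropy_eq_log_ncard, ncard_range_subTuple_cosetTuple]
  linarith

/-! ### Asymptotics of multinomial coefficients -/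

/-- A weak form of Stirling's formula. -/
lemma abs_log_factorial_sub_le (k : ℕ) :
    |Real.log (k ! : ℝ) - (k * Real.log k - k)| ≤ 2 * Real.log (k + 1) := by
  rw [abs_le]
  induction k with
  | zero => simp
  | succ k ih =>
    have hfac : Real.log ((k + 1)! : ℝ) = Real.log (k + 1) + Real.log (k ! : ℝ) := by
      rw [Nat.factorial_succ]
      push_cast
      rw [Real.log_mul (by positivity) (by positivity)]
    have h2 : Real.log (k + 1 : ℝ) + 1 / (2 * (k + 1)) ≤ Real.log (k + 1 + 1 : ℝ) := by
      have := Real.one_sub_inv_le_log_of_pos (by positivity : 0 < ((k : ℝ) + 1 + 1) / (k + 1))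
      rw [Real.log_div (by positivity) (by positivity), inv_div] at this
      have h3 : (1 : ℝ) / (2 * (k + 1)) ≤ 1 - (k + 1) / (k + 1 + 1) := by
        rw [one_sub_div (by positivity), div_le_div_iff₀ (by positivity) (by positivity)]
        have : (0 : ℝ) ≤ k := Nat.cast_nonneg k
        nlinarith
      linarith
    rw [hfac]
    push_cast
    rcases Nat.eq_zero_or_pos k with rfl | hk
    · norm_num
      have := Real.log_two_gt_d9
      constructor <;> linarith
    have hk' : (0 : ℝ) < k := by exact_mod_cast hk
    have h4 : k * (Real.log (k + 1) - Real.log k) ≤ 1 := by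
      have := Real.log_le_sub_one_of_pos (by positivity : 0 < ((k : ℝ) + 1) / k)
      rw [Real.log_div (by positivity) (by positivity)] at this
      calc _ ≤ k * (((k : ℝ) + 1) / k - 1) := by gcongr
        _ = 1 := by field_simp; ring
    have h5 : 1 - 1 / (k + 1) ≤ k * (Real.log (k + 1) - Real.log k) := by
      have := Real.one_sub_inv_le_log_of_pos (by positivity : 0 < ((k : ℝ) + 1) / k)
      rw [Real.log_div (by positivity) (by positivity), inv_div] at this
      calc _ = k * (1 - (k : ℝ) / (k + 1)) := by field_simp; ring
        _ ≤ _ := by gcongr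
    have h6 : (1 : ℝ) / (k + 1) = 2 * (1 / (2 * (k + 1))) := by field_simp
    have h7 : 0 ≤ Real.log (k + 1 + 1 : ℝ) := Real.log_nonneg (by linarith)
    have h8 : 0 < (1 : ℝ) / (2 * (k + 1)) := by positivity
    constructor <;> nlinarith [ih.1, ih.2]

lemma tendsto_log_factorial_div {k : ℕ → ℕ} {c : ℝ} (hk : ∀ n, k n ≤ n)
    (hc : Tendsto (fun n => (k n : ℝ) / n) atTop (𝓝 c)) :
    Tendsto (fun n => (Real.log ((k n)! : ℝ) - k n * Real.log n + k n) / n) atTop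
      (𝓝 (-Real.negMulLog c)) := by
  have h1 : Tendsto (fun n => -Real.negMulLog ((k n : ℝ) / n)) atTop (𝓝 (-Real.negMulLog c)) :=
    ((Real.continuous_negMulLog.tendsto c).comp hc).neg
  have h2 : Tendsto (fun n : ℕ => 2 * Real.log (n + 1) / n) atTop (𝓝 0) := by
    have hlog : Tendsto (fun x : ℝ => Real.log x / x) atTop (𝓝 0) :=
      Real.isLittleO_log_id_atTop.tendsto_div_nhds_zero
    have h3 := (hlog.comp (tendsto_atTop_add_const_right _ 1 tendsto_natCast_atTop_atTop :
      Tendsto (fun n : ℕ => (n : ℝ) + 1) atTop atTop))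
    have h4 : Tendsto (fun n : ℕ => 2 * (1 + 1 / (n : ℝ))) atTop (𝓝 (2 * (1 + 0))) :=
      (tendsto_const_nhds.add tendsto_one_div_atTop_nhds_zero_nat).const_mul 2
    have h5 := h4.mul h3
    rw [mul_zero] at h5
    refine h5.congr' ?_
    filter_upwards [eventually_gt_atTop 0] with n hn
    have : (0 : ℝ) < n := by exact_mod_cast hn
    simp only [Function.comp_apply]
    field_simp
  have h3 : Tendsto (fun n => (Real.log ((k n)! : ℝ) - (k n * Real.log (k n) - k n)) / n) atTop
      (𝓝 0) := by
    refine squeeze_zero_norm (fun n => ?_) h2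
    rw [Real.norm_eq_abs, abs_div, Nat.abs_cast]
    gcongr
    refine (abs_log_factorial_sub_le (k n)).trans ?_
    gcongr
    exact hk n
  have h4 := h1.add h3
  rw [add_zero] at h4
  refine h4.congr' ?_
  filter_upwards [eventually_gt_atTop 0] with n hn
  have hn' : (n : ℝ) ≠ 0 := by exact_mod_cast hn.ne'
  rcases Nat.eq_zero_or_pos (k n) with h0 | h0
  · simp [h0]
  · have hk' : (k n : ℝ) ≠ 0 := by exact_mod_cast h0.ne'
    rw [Real.negMulLog, Real.log_div hk' hn']
    field_simp
    ring

/-! ### Approximation of entropies by coset entropies -/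

/-- Up to scaling, every tuple of entropies is a limit of tuples of coset entropies. The group for
the scale `n` permutes a set that contains `⌊n p(ω)⌋` copies of every `ω`. -/
lemma exists_tendsto_cosetEntropy {m : ℕ} {Ω : Type} [Fintype Ω] {β : Fin m → Type}
    [∀ i, Fintype (β i)] (ξ : ∀ i, Ω → β i) {p : Ω → ℝ} (hp : p ∈ stdSimplex ℝ Ω) :
    ∃ (Y : ℕ → Type) (_ : ∀ n, Finite (Y n)) (H : ∀ n, Fin m → Subgroup (Equiv.Perm (Y n))),
      ∀ I, Tendsto (fun n : ℕ => cosetEntropy (H n) I / n) atTop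
        (𝓝 (pushEntropy p (subTuple ξ I))) := by
  classical
  let N : ℕ → Ω → ℕ := fun n ω => ⌊p ω * n⌋₊
  have hN : ∀ ω, Tendsto (fun n : ℕ => (N n ω : ℝ) / n) atTop (𝓝 (p ω)) := fun ω =>
    (tendsto_nat_floor_mul_div_atTop (R := ℝ) (hp.1 ω)).comp tendsto_natCast_atTop_atTop
  have hle : ∀ (s : Finset Ω) n, ∑ ω ∈ s, N n ω ≤ n := by
    intro s n
    have : (∑ ω ∈ s, (N n ω : ℝ)) ≤ n := calc
      _ ≤ ∑ ω, (N n ω : ℝ) :=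
        Finset.sum_le_sum_of_subset_of_nonneg (Finset.subset_univ s) fun _ _ _ => Nat.cast_nonneg _
      _ ≤ ∑ ω, p ω * n := Finset.sum_le_sum fun ω _ =>
        Nat.floor_le (mul_nonneg (hp.1 ω) (Nat.cast_nonneg _))
      _ = n := by rw [← Finset.sum_mul, hp.2, one_mul]
    exact_mod_cast this
  have hsum : ∀ s : Finset Ω, Tendsto (fun n : ℕ => ((∑ ω ∈ s, N n ω : ℕ) : ℝ) / n) atTop
      (𝓝 (∑ ω ∈ s, p ω)) := fun s => by
    simp only [Nat.cast_sum, Finset.sum_div]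
    exact tendsto_finsetSum _ fun ω _ => hN ω
  refine ⟨fun n => Σ ω, Fin (N n ω), fun n => inferInstance,
    fun n i => labelSubgroup fun y => ξ i y.1, fun I => ?_⟩
  have hcardY : ∀ n, Fintype.card (Σ ω, Fin (N n ω)) = ∑ ω, N n ω := fun n => by simp
  have hfib : ∀ n b, (subTuple (fun i (y : Σ ω, Fin (N n ω)) => ξ i y.1) I ⁻¹' {b}).ncard =
      ∑ ω with subTuple ξ I ω = b, N n ω := by
    intro n b
    have : subTuple (fun i (y : Σ ω, Fin (N n ω)) => ξ i y.1) I ⁻¹' {b} =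
        ((Finset.univ.filter fun ω => subTuple ξ I ω = b).sigma
          fun ω => (Finset.univ : Finset (Fin (N n ω))) : Finset (Σ ω, Fin (N n ω))) := by
      ext y
      simp only [mem_preimage, mem_singleton_iff, Finset.mem_coe, Finset.mem_sigma,
        Finset.mem_filter, Finset.mem_univ, true_and, and_true]
      rfl
    rw [this, Set.ncard_coe_finset, Finset.card_sigma]
    simp
  have h1 := tendsto_log_factorial_div (fun n => hle Finset.univ n) (hsum Finset.univ)
  have h2 := tendsto_finsetSum Finset.univ fun b _ =>
    tendsto_log_factorial_div (fun n => hle (Finset.univ.filter fun ω => subTuple ξ I ω = b) n)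
      (hsum (Finset.univ.filter fun ω => subTuple ξ I ω = b))
  have h3 := h1.sub h2
  rw [hp.2, Real.negMulLog_one, neg_zero, zero_sub, Finset.sum_neg_distrib, neg_neg] at h3
  have hlim : ∑ b, Real.negMulLog (∑ ω with subTuple ξ I ω = b, p ω) =
      pushEntropy p (subTuple ξ I) := by
    unfold pushEntropy pushWeight
    refine Finset.sum_congr rfl fun b _ => congrArg _ (Finset.sum_congr ?_ fun _ _ => rfl)
    ext
    simp
  rw [hlim] at h3
  refine h3.congr fun n => ?_
  rw [cosetEntropy_labelSubgroup (fun i (y : Σ ω, Fin (N n ω)) => ξ i y.1) I, hcardY,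
    ← Finset.sum_div, ← sub_div]
  congr 1
  simp only [hfib]
  have hpart : ∑ b, ∑ ω with subTuple ξ I ω = b, N n ω = ∑ ω, N n ω :=
    Finset.sum_fiberwise _ _ _
  have hpart' : (∑ b, ((∑ ω with subTuple ξ I ω = b, N n ω : ℕ) : ℝ)) =
      ((∑ ω, N n ω : ℕ) : ℝ) := by exact_mod_cast hpart
  rw [Finset.sum_add_distrib, Finset.sum_sub_distrib, ← Finset.sum_mul, hpart']
  ring

end

/-! ### Coset variables that violate the inequality -/

lemma shannonEntropy_comp_injective {Ω β γ : Type} [MeasurableSpace Ω] [Finite β] [Finite γ]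
    (P : Measure Ω) (X : Ω → β) {φ : β → γ} (hφ : Function.Injective φ) :
    shannonEntropy P (fun ω => φ (X ω)) = shannonEntropy P X := by
  have h : ∀ b, (fun ω => φ (X ω)) ⁻¹' {φ b} = X ⁻¹' {b} := fun b => by
    ext ω
    simp [hφ.eq_iff]
  rw [shannonEntropy, ← finsum_mem_univ, finsum_mem_inter_support_eq' (t := range φ),
    finsum_mem_range hφ]
  · simp only [h, shannonEntropy]
  · intro c hc
    refine ⟨fun _ => ?_, fun _ => mem_univ _⟩
    by_contra hcr
    refine hc ?_
    have : (fun ω => φ (X ω)) ⁻¹' {c} = ∅ := by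
      ext ω
      simp only [mem_preimage, mem_singleton_iff, mem_empty_iff_false, iff_false]
      exact fun h => hcr ⟨_, h⟩
    simp [this]

/-- A violation of the inequality for entropies can be found on a finite probability space, with
all variables non-constant. To get this, a new value is added to every variable and the
distribution is moved slightly towards the uniform one. -/
lemma exists_weights_of_not_entropyInequality {m : ℕ} {𝓘 𝓙 : Finset (Finset (Fin m))}
    {lam mu : Finset (Fin m) → ℝ≥0} (hE : ¬ EntropyInequality 𝓘 𝓙 lam mu) :
    ∃ (Ω : Type) (_ : Fintype Ω) (β : Fin m → Type) (_ : ∀ i, Fintype (β i)) (ξ : ∀ i, Ω → β i)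
      (p : Ω → ℝ), p ∈ stdSimplex ℝ Ω ∧
        ∑ J ∈ 𝓙, (mu J : ℝ) * pushEntropy p (subTuple ξ J) <
          ∑ I ∈ 𝓘, (lam I : ℝ) * pushEntropy p (subTuple ξ I) ∧
        ∀ I : Finset (Fin m), I.Nonempty → 0 < pushEntropy p (subTuple ξ I) := by
  classical
  unfold EntropyInequality at hE
  push Not at hE
  obtain ⟨Ω, _, P, _, α, _, _, _, ξ, hξ, hlt⟩ := hE
  have hΩ : Nonempty Ω := nonempty_of_isProbabilityMeasure P
  have hα : ∀ i, Fintype (α i) := fun i => Fintype.ofFinite _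
  let X := ∀ i, Option (α i)
  let ζ : Ω → X := fun ω i => some (ξ i ω)
  let η : ∀ i, X → Option (α i) := fun i x => x i
  have hζ : ∀ x, MeasurableSet (ζ ⁻¹' {x}) := by
    intro x
    have : ζ ⁻¹' {x} = ⋂ i, ξ i ⁻¹' {a | some a = x i} := by
      ext ω
      simp only [mem_preimage, mem_singleton_iff, mem_iInter, mem_ofPred_eq]
      exact funext_iff
    rw [this]
    exact MeasurableSet.iInter fun i => hξ i (Set.toFinite _).measurableSet
  let p₀ : X → ℝ := fun x => P.real (ζ ⁻¹' {x})
  have hp₀ : p₀ ∈ stdSimplex ℝ X := by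
    refine ⟨fun x => measureReal_nonneg, ?_⟩
    rw [← measureReal_biUnion_finset (fun x _ y _ hxy => Disjoint.preimage ζ (by simpa using hxy))
      fun x _ => hζ x]
    rw [← probReal_univ (μ := P)]
    congr 1
    ext ω
    simp
  have hent : ∀ I, pushEntropy p₀ (subTuple η I) = shannonEntropy P (subTuple ξ I) := by
    intro I
    rw [← shannonEntropy_comp P ζ hζ (subTuple η I)]
    exact shannonEntropy_comp_injective P (subTuple ξ I)
      (φ := fun v i => some (v i)) fun v w h =>
        funext fun i => Option.some_injective _ (congrFun h i)
  have hXc : (0 : ℝ) < Fintype.card X := by exact_mod_cast Fintype.card_pos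
  let u : X → ℝ := fun _ => (Fintype.card X : ℝ)⁻¹
  have hu : u ∈ stdSimplex ℝ X := by
    refine ⟨fun x => by positivity, ?_⟩
    simp only [u, Finset.sum_const, Finset.card_univ, nsmul_eq_mul]
    exact mul_inv_cancel₀ hXc.ne'
  let p : ℝ → X → ℝ := fun ε => (1 - ε) • p₀ + ε • u
  have hp : Continuous p := by fun_prop
  have hcont : ∀ (s : Finset (Finset (Fin m))) (l : Finset (Fin m) → ℝ≥0),
      Continuous fun ε => ∑ I ∈ s, (l I : ℝ) * pushEntropy (p ε) (subTuple η I) := fun s l =>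
    continuous_finsetSum _ fun I _ =>
      continuous_const.mul ((continuous_pushEntropy (subTuple η I)).comp hp)
  have hev : ∀ᶠ ε in 𝓝[>] (0 : ℝ), ∑ J ∈ 𝓙, (mu J : ℝ) * pushEntropy (p ε) (subTuple η J) <
      ∑ I ∈ 𝓘, (lam I : ℝ) * pushEntropy (p ε) (subTuple η I) := by
    refine Filter.Eventually.filter_mono nhdsWithin_le_nhds ?_
    refine (hcont 𝓙 mu).continuousAt.eventually_lt (hcont 𝓘 lam).continuousAt ?_
    have : p 0 = p₀ := by simp [p]
    simpa only [this, hent] using hlt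
  obtain ⟨ε, hε, hε0, hε1⟩ := (hev.and (Ioo_mem_nhdsGT (zero_lt_one' ℝ))).exists
  refine ⟨X, inferInstance, fun i => Option (α i), fun i => inferInstance, η, p ε,
    convex_stdSimplex ℝ X hp₀ hu (by linarith) hε0.le (by ring), hε, fun I ⟨i, hi⟩ => ?_⟩
  refine pushEntropy_pos (convex_stdSimplex ℝ X hp₀ hu (by linarith) hε0.le (by ring))
    (fun x => ?_) _ (x := fun _ => none) (y := ζ (Classical.arbitrary Ω)) fun h => ?_
  · have h1 := mul_nonneg (by linarith : 0 ≤ 1 - ε) (hp₀.1 x)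
    have h2 : 0 < ε * (Fintype.card X : ℝ)⁻¹ := by positivity
    simp only [u, Pi.add_apply, Pi.smul_apply, smul_eq_mul]
    linarith
  · simpa [subTuple, η, ζ] using congrFun h ⟨i, hi⟩

/-- Coset variables that violate the inequality can be taken non-constant. This is needed because a
variable of zero entropy gives a projection to a single point, for which dimension `0` is no
restriction. -/
lemma exists_cosetEntropy_lt_of_not_entropyInequality {m : ℕ} {𝓘 𝓙 : Finset (Finset (Fin m))}
    {lam mu : Finset (Fin m) → ℝ≥0} (h𝓘 : ∀ I ∈ 𝓘, I.Nonempty)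
    (hE : ¬ EntropyInequality 𝓘 𝓙 lam mu) :
    ∃ (G : Type) (_ : Group G) (_ : Finite G) (H : Fin m → Subgroup G),
      ∑ J ∈ 𝓙, (mu J : ℝ) * cosetEntropy H J < ∑ I ∈ 𝓘, (lam I : ℝ) * cosetEntropy H I ∧
      ∀ I ∈ 𝓘, 0 < cosetEntropy H I := by
  obtain ⟨Ω, _, β, _, ξ, p, hp, hlt, hpos⟩ := exists_weights_of_not_entropyInequality hE
  obtain ⟨Y, _, H, hlim⟩ := exists_tendsto_cosetEntropy ξ hp
  have hsum : ∀ (s : Finset (Finset (Fin m))) (l : Finset (Fin m) → ℝ≥0),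
      Tendsto (fun n : ℕ => ∑ I ∈ s, (l I : ℝ) * (cosetEntropy (H n) I / n)) atTop
        (𝓝 (∑ I ∈ s, (l I : ℝ) * pushEntropy p (subTuple ξ I))) := fun s l =>
    tendsto_finsetSum _ fun I _ => (hlim I).const_mul _
  have h1 := (hsum 𝓙 mu).eventually_lt (hsum 𝓘 lam) hlt
  have h2 : ∀ᶠ n : ℕ in atTop, ∀ I ∈ 𝓘, 0 < cosetEntropy (H n) I / n :=
    (Filter.eventually_all_finset _).2 fun I hI =>
      (hlim I).eventually_const_lt (hpos I (h𝓘 I hI))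
  obtain ⟨n, ⟨h1, h2⟩, hn⟩ := ((h1.and h2).and (eventually_gt_atTop 0)).exists
  have hn' : (0 : ℝ) < n := by exact_mod_cast hn
  refine ⟨Equiv.Perm (Y n), inferInstance, inferInstance, H n, ?_, fun I hI => ?_⟩
  · simp only [← mul_div_assoc, ← Finset.sum_div] at h1
    exact (div_lt_div_iff_of_pos_right hn').1 h1
  · exact (div_pos_iff_of_pos_right hn').1 (h2 I hI)

/-! ### Digit expansions -/

/-- The integer with the `N`-ary digits `x 0, …, x (n - 1)`, the leading one first. -/
def digitPrefix {N : ℕ} (x : ℕ → Fin N) : ℕ → ℕ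
  | 0 => 0
  | n + 1 => digitPrefix x n * N + x n

lemma eq_of_digitPrefix_eq {N : ℕ} {x y : ℕ → Fin N} {n : ℕ}
    (h : digitPrefix x n = digitPrefix y n) : ∀ k < n, x k = y k := by
  induction n with
  | zero => simp
  | succ n ih =>
    simp only [digitPrefix] at h
    have hmod := congrArg (· % N) h
    simp only [Nat.mul_add_mod_self_right, Nat.mod_eq_of_lt (Fin.is_lt _)] at hmod
    rw [hmod] at h
    have hN : 0 < N := Fin.pos (x 0)
    have := Nat.eq_of_mul_eq_mul_right hN (Nat.add_right_cancel h)
    intro k hk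
    rcases Nat.lt_succ_iff_lt_or_eq.1 hk with hk | rfl
    exacts [ih this k hk, Fin.ext hmod]

lemma sum_ofDigitsTerm_eq_digitPrefix_div {N : ℕ} (x : ℕ → Fin N) (n : ℕ) :
    ∑ k ∈ Finset.range n, Real.ofDigitsTerm x k = digitPrefix x n / (N : ℝ) ^ n := by
  have hN : (N : ℝ) ≠ 0 := by exact_mod_cast (Fin.pos (x 0)).ne'
  induction n with
  | zero => simp [digitPrefix]
  | succ n ih =>
    rw [Finset.sum_range_succ, ih, Real.ofDigitsTerm, digitPrefix]
    push_cast
    field_simp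
    ring

/-- Sequences of digits of numbers at distance at most `N⁻ⁿ` have prefixes of length `n` that
differ by at most `2`. -/
lemma abs_digitPrefix_sub_le {N : ℕ} {x y : ℕ → Fin N} {n : ℕ}
    (h : |Real.ofDigits x - Real.ofDigits y| ≤ ((N : ℝ) ^ n)⁻¹) :
    |(digitPrefix x n : ℤ) - digitPrefix y n| ≤ 2 := by
  have hN : (0 : ℝ) < (N : ℝ) ^ n := by
    have : 0 < N := Fin.pos (x 0)
    positivity
  rw [Real.ofDigits_eq_sum_add_ofDigits x n, Real.ofDigits_eq_sum_add_ofDigits y n,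
    sum_ofDigitsTerm_eq_digitPrefix_div, sum_ofDigitsTerm_eq_digitPrefix_div, ← one_div,
    le_div_iff₀ hN, ← abs_of_pos hN, ← abs_mul, abs_of_pos hN] at h
  have hx0 := Real.ofDigits_nonneg fun k => x (k + n)
  have hx1 := Real.ofDigits_le_one fun k => x (k + n)
  have hy0 := Real.ofDigits_nonneg fun k => y (k + n)
  have hy1 := Real.ofDigits_le_one fun k => y (k + n)
  set u := Real.ofDigits fun k => x (k + n)
  set v := Real.ofDigits fun k => y (k + n)
  have h' : |(digitPrefix x n : ℝ) - digitPrefix y n + (u - v)| ≤ 1 := by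
    refine le_of_eq_of_le (congrArg _ ?_) h
    field_simp
    ring
  have h2 : |(digitPrefix x n : ℝ) - digitPrefix y n| ≤ 2 := by
    rw [abs_le] at h' ⊢
    constructor <;> linarith
  exact_mod_cast h2

section
variable {m N : ℕ} {G : Type} [Group G] (H : Fin m → Subgroup G) (e : ∀ i, (G ⧸ H i) ↪ Fin N)
  (I : Finset (Fin m))

/-- The digits of the `i`-th coordinate of the point with address `d`. -/
def cosetDigit (d : ℕ → G) (i : Fin m) (k : ℕ) : Fin N := e i (cosetTuple H i (d k))

/-- The `I`-coordinates of the point of the Cantor-type set of coset digits that a sequence of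
elements of `G` encodes. -/
noncomputable def cosetPoint (d : ℕ → G) (i : I) : ℝ := Real.ofDigits (cosetDigit H e d i)

lemma cosetDigit_eq_iff {d d' : ℕ → G} {k : ℕ} :
    (∀ i : I, cosetDigit H e d i k = cosetDigit H e d' i k) ↔
      subTuple (cosetTuple H) I (d k) = subTuple (cosetTuple H) I (d' k) := by
  simp [cosetDigit, funext_iff, subTuple]

lemma proj_cantorSet_cosetDigits :
    proj I (cantorSet N (cosetDigits H e)) = range (cosetPoint H e I) := by
  ext x
  constructor
  · rintro ⟨y, ⟨d, hd, hy⟩, rfl⟩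
    choose g hg using hd
    refine ⟨g, funext fun i => ?_⟩
    dsimp only
    rw [hy, cosetPoint]
    congr 1
    ext k
    rw [← hg k]
    rfl
  · rintro ⟨d, rfl⟩
    exact ⟨fun i => Real.ofDigits (cosetDigit H e d i),
      ⟨fun k i => cosetDigit H e d i k, fun k => ⟨d k, rfl⟩, fun i => rfl⟩, rfl⟩

/-! ### Packing dimension of the projections -/

lemma externalCoveringNumber_range_cosetPoint_le [Finite G] {n : ℕ} {r : ℝ≥0}
    (hr : ((N : ℝ) ^ n)⁻¹ ≤ r) :
    Metric.externalCoveringNumber r (range (cosetPoint H e I)) ≤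
      (((range (subTuple (cosetTuple H) I)).ncard ^ n : ℕ) : ℕ∞) := by
  -- The centers are the points of addresses with arbitrary first `n` cosets and then the unit.
  let R := range (subTuple (cosetTuple H) I)
  let c : (Fin n → R) → I → ℝ := fun w =>
    cosetPoint H e I fun k => if h : k < n then (w ⟨k, h⟩).2.choose else 1
  have hC : Metric.IsCover r (range (cosetPoint H e I)) (range c) := by
    rintro _ ⟨d, rfl⟩
    refine ⟨_, ⟨fun k => ⟨subTuple (cosetTuple H) I (d k), mem_range_self _⟩, rfl⟩, ?_⟩
    change edist _ _ ≤ _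
    rw [edist_nndist, ENNReal.coe_le_coe, ← NNReal.coe_le_coe, coe_nndist]
    refine (dist_pi_le_iff r.2).2 fun i => le_trans ?_ hr
    rw [Real.dist_eq]
    refine Real.abs_ofDigits_sub_ofDigits_le fun k hk => ?_
    refine (cosetDigit_eq_iff H e I).2 ?_ i
    rw [dif_pos hk]
    exact (Exists.choose_spec (⟨d k, rfl⟩ : subTuple (cosetTuple H) I (d k) ∈ R)).symm
  refine hC.externalCoveringNumber_le_encard.trans ?_
  rw [← image_univ]
  refine (Set.encard_image_le _ _).trans_eq ?_
  rw [Set.encard_univ, ENat.card_eq_coe_natCard, Nat.card_fun, Nat.card_fin]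
  rfl

lemma upperBoxDim_range_cosetPoint_le [Finite G] (hN : 2 ≤ N) :
    upperBoxDim (range (cosetPoint H e I)) ≤
      ENNReal.ofReal (cosetEntropy H I / Real.log N) := by
  have hlogN : 0 < Real.log N := Real.log_pos (by exact_mod_cast hN)
  rw [cosetEntropy_eq_log_ncard]
  set c := (range (subTuple (cosetTuple H) I)).ncard with hc_def
  have hc : 0 < c := (Set.ncard_pos (Set.toFinite _)).2 (range_nonempty _)
  have hlogc : 0 ≤ Real.log c := Real.log_natCast_nonneg c
  have hL : Tendsto (fun r : ℝ≥0 => Real.log (1 / (r : ℝ))) (𝓝[>] 0) atTop := by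
    have h1 : Tendsto (fun r : ℝ≥0 => (r : ℝ)) (𝓝[>] 0) (𝓝[>] 0) := by
      refine tendsto_nhdsWithin_iff.2 ⟨?_, ?_⟩
      · exact (NNReal.continuous_coe.tendsto 0).mono_left nhdsWithin_le_nhds
      · filter_upwards [self_mem_nhdsWithin] with r hr
        exact_mod_cast hr
    simp only [one_div]
    exact Real.tendsto_log_atTop.comp (tendsto_inv_nhdsGT_zero.comp h1)
  have hlim : Tendsto (fun r : ℝ≥0 => ((Real.log c / Real.log N +
      Real.log c / Real.log (1 / (r : ℝ)) : ℝ) : EReal)) (𝓝[>] 0)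
        (𝓝 ((Real.log c / Real.log N : ℝ) : EReal)) := by
    have h := (hL.const_div_atTop (Real.log c)).const_add (Real.log c / Real.log N)
    rw [add_zero] at h
    exact (continuous_coe_real_ereal.tendsto _).comp h
  have hle : limsup (fun r : ℝ≥0 => ENNReal.log ((Metric.externalCoveringNumber r
      (range (cosetPoint H e I)) : ℕ∞) : ℝ≥0∞) / ((Real.log (1 / (r : ℝ)) : ℝ) : EReal)) (𝓝[>] 0) ≤
        ((Real.log c / Real.log N : ℝ) : EReal) := by
    rw [← hlim.limsup_eq]
    refine limsup_le_limsup ?_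
    filter_upwards [hL.eventually_gt_atTop 0, self_mem_nhdsWithin] with r hr hr0
    have hr0' : (0 : ℝ) < r := by exact_mod_cast hr0
    -- `n` is the least exponent with `N⁻ⁿ ≤ r`.
    set n := ⌈Real.log (1 / (r : ℝ)) / Real.log N⌉₊
    have hn1 : Real.log (1 / (r : ℝ)) ≤ n * Real.log N := (div_le_iff₀ hlogN).1 (Nat.le_ceil _)
    have hn2 : (n : ℝ) ≤ Real.log (1 / (r : ℝ)) / Real.log N + 1 :=
      (Nat.ceil_lt_add_one (by positivity)).le
    have hrn : ((N : ℝ) ^ n)⁻¹ ≤ r := by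
      have hN0 : (0 : ℝ) < N := by exact_mod_cast (by omega : 0 < N)
      rw [inv_le_comm₀ (by positivity) hr0', ← one_div,
        ← Real.log_le_log_iff (by positivity) (by positivity), Real.log_pow]
      exact hn1
    have hcard := externalCoveringNumber_range_cosetPoint_le H e I hrn
    have hlog : ENNReal.log ((Metric.externalCoveringNumber r
        (range (cosetPoint H e I)) : ℕ∞) : ℝ≥0∞) ≤ ((n * Real.log c : ℝ) : EReal) := by
      rw [← Real.log_pow, ← ENNReal.log_ofReal_of_pos (by positivity)]
      refine ENNReal.log_le_log ?_
      refine (ENat.toENNReal_le.2 hcard).trans_eq ?_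
      rw [ENat.toENNReal_coe, ← Nat.cast_pow, ENNReal.ofReal_natCast]
    refine (EReal.div_le_div_right_of_nonneg (by exact_mod_cast hr.le) hlog).trans ?_
    rw [← EReal.coe_div, EReal.coe_le_coe_iff, div_le_iff₀ hr, add_mul, div_mul_cancel₀ _ hr.ne']
    calc n * Real.log c ≤ (Real.log (1 / (r : ℝ)) / Real.log N + 1) * Real.log c := by gcongr
      _ = _ := by ring
  have := EReal.toENNReal_le_toENNReal hle
  rwa [EReal.toENNReal_of_ne_top (EReal.coe_ne_top _), EReal.toReal_coe] at this

lemma packingDim_proj_cantorSet_le [Finite G] (hN : 2 ≤ N) :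
    packingDim (proj I (cantorSet N (cosetDigits H e))) ≤
      ENNReal.ofReal (cosetEntropy H I / Real.log N) := by
  rw [proj_cantorSet_cosetDigits]
  refine (iInf₂_le (fun _ => range (cosetPoint H e I)) ?_).trans
    (iSup_le fun _ => upperBoxDim_range_cosetPoint_le H e I hN)
  exact (subset_iUnion (fun _ : ℕ => range (cosetPoint H e I)) 0)

/-! ### Mass distribution on the projections -/

/-- The law of a sequence of independent uniformly distributed elements of `G`. -/
noncomputable def uniformSeq (G : Type) [Finite G] [MeasurableSpace G] : Measure (ℕ → G) :=
  Measure.infinitePi fun _ => ProbabilityTheory.uniformOn univ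

variable [Finite G] [MeasurableSpace G] [MeasurableSingletonClass G]

lemma isProbabilityMeasure_uniformOn_univ :
    IsProbabilityMeasure (ProbabilityTheory.uniformOn (univ : Set G)) :=
  ProbabilityTheory.isProbabilityMeasure_uniformOn Set.finite_univ univ_nonempty

lemma uniformSeq_univ : uniformSeq G univ = 1 := by
  have := isProbabilityMeasure_uniformOn_univ (G := G)
  rw [uniformSeq]
  exact measure_univ

lemma uniformSeq_cylinder (d : ℕ → G) (n : ℕ) :
    uniformSeq G {d' | ∀ k < n, subTuple (cosetTuple H) I (d' k) =
      subTuple (cosetTuple H) I (d k)} =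
        ENNReal.ofReal (((range (subTuple (cosetTuple H) I)).ncard : ℝ)⁻¹ ^ n) := by
  have := isProbabilityMeasure_uniformOn_univ (G := G)
  have h : {d' : ℕ → G | ∀ k < n, subTuple (cosetTuple H) I (d' k) =
      subTuple (cosetTuple H) I (d k)} = Set.pi (Finset.range n) fun k =>
        subTuple (cosetTuple H) I ⁻¹' {subTuple (cosetTuple H) I (d k)} := by
    ext d'
    simp [Set.mem_pi]
  rw [h, uniformSeq, Measure.infinitePi_pi _ fun k _ => (Set.toFinite _).measurableSet,
    Finset.prod_congr rfl fun k _ => by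
      rw [← ofReal_measureReal, uniformOn_real_fiber_subTuple_cosetTuple],
    Finset.prod_const, Finset.card_range, ENNReal.ofReal_pow (by positivity)]

lemma measurable_cosetPoint : Measurable (cosetPoint H e I) := by
  refine measurable_pi_lambda _ fun i => ?_
  have h1 : Measurable fun d : ℕ → G => cosetDigit H e d i :=
    measurable_pi_lambda _ fun k =>
      (measurable_of_finite fun g => e i (cosetTuple H i g)).comp (measurable_pi_apply k)
  exact Real.continuous_ofDigits.measurable.comp h1

/-- A set of diameter at most `N⁻ⁿ` meets boundedly many cylinders of length `n`. -/
lemma uniformSeq_preimage_cosetPoint_le {U : Set (I → ℝ)} {n : ℕ}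
    (hU : Metric.ediam U ≤ ENNReal.ofReal (((N : ℝ) ^ n)⁻¹)) :
    uniformSeq G (cosetPoint H e I ⁻¹' U) ≤ 5 ^ Fintype.card I *
      ENNReal.ofReal (((range (subTuple (cosetTuple H) I)).ncard : ℝ)⁻¹ ^ n) := by
  classical
  rcases (cosetPoint H e I ⁻¹' U).eq_empty_or_nonempty with h0 | ⟨d₀, hd₀⟩
  · rw [h0, measure_empty]
    exact zero_le
  -- In each coordinate, the digit prefixes differ by at most `2` from those of a fixed point, so
  -- there are at most `5` of them.
  let pre : (ℕ → G) → I → ℤ := fun d i => digitPrefix (cosetDigit H e d i) n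
  let V : Finset (I → ℤ) := Fintype.piFinset fun i => Finset.Icc (pre d₀ i - 2) (pre d₀ i + 2)
  have hV : V.card = 5 ^ Fintype.card I := by
    rw [Fintype.card_piFinset, Finset.prod_congr rfl (g := fun _ => 5) fun i _ => by
      rw [Int.card_Icc]; ring_nf; rfl]
    simp
  have hsub : cosetPoint H e I ⁻¹' U ⊆ ⋃ v ∈ V, {d | pre d = v} := by
    intro d hd
    refine mem_iUnion₂.2 ⟨pre d, ?_, rfl⟩
    simp only [V, Fintype.mem_piFinset, Finset.mem_Icc]
    intro i
    have h1 := (Metric.edist_le_ediam_of_mem (mem_preimage.1 hd) (mem_preimage.1 hd₀)).trans hU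
    rw [edist_dist, ENNReal.ofReal_le_ofReal_iff (by positivity)] at h1
    have h2 := (dist_le_pi_dist _ _ i).trans h1
    rw [Real.dist_eq] at h2
    have h3 := abs_le.1 (abs_digitPrefix_sub_le h2)
    constructor <;> simp only [pre] <;> linarith
  refine (measure_mono hsub).trans ((measure_biUnion_finset_le _ _).trans ?_)
  refine (Finset.sum_le_card_nsmul _ _
    (ENNReal.ofReal (((range (subTuple (cosetTuple H) I)).ncard : ℝ)⁻¹ ^ n)) fun v _ => ?_).trans_eq
    (by rw [hV, nsmul_eq_mul]; push_cast; rfl)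
  rcases {d | pre d = v}.eq_empty_or_nonempty with h0 | ⟨d, rfl⟩
  · rw [h0, measure_empty]
    exact zero_le
  · rw [← uniformSeq_cylinder H I d n]
    refine measure_mono fun d' hd' k hk => ?_
    refine (cosetDigit_eq_iff H e I).1 fun i => ?_
    have h := congrFun (hd' : pre d' = pre d) i
    exact eq_of_digitPrefix_eq (Nat.cast_injective (R := ℤ) h) k hk

/-- The mass distribution principle for the projections of the Cantor-type set. -/
lemma uniformSeq_preimage_eq_zero_of_dimH_lt (hN : 2 ≤ N) (hI : 0 < cosetEntropy H I)
    {U : Set (I → ℝ)} (hU : dimH U < ENNReal.ofReal (cosetEntropy H I / Real.log N)) :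
    uniformSeq G (cosetPoint H e I ⁻¹' U) = 0 := by
  have hlogN : 0 < Real.log N := Real.log_pos (by exact_mod_cast hN)
  have hN0 : (0 : ℝ) < N := by exact_mod_cast (by omega : 0 < N)
  rw [cosetEntropy_eq_log_ncard] at hI hU
  set c := (range (subTuple (cosetTuple H) I)).ncard with hc_def
  have hc1 : 1 < (c : ℝ) := by
    by_contra! h
    exact absurd (Real.log_nonpos (Nat.cast_nonneg c) h) (not_le.2 hI)
  have hc0 : 0 < (c : ℝ) := by linarith
  set s : ℝ := Real.log c / Real.log N with hs_def
  have hs : 0 < s := div_pos hI hlogN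
  have hcs : ∀ n : ℕ, ENNReal.ofReal (((N : ℝ) ^ n)⁻¹) ^ s = ENNReal.ofReal ((c : ℝ)⁻¹ ^ n) := by
    intro n
    rw [ENNReal.ofReal_rpow_of_pos (by positivity), Real.rpow_def_of_pos (by positivity),
      Real.log_inv, Real.log_pow, hs_def, inv_pow, ← Real.exp_log (by positivity : 0 < ((c : ℝ) ^ n)⁻¹),
      Real.log_inv, Real.log_pow]
    congr 2
    field_simp
  set ν := (uniformSeq G).map (cosetPoint H e I)
  have hmeas := measurable_cosetPoint H e I
  have hν : ∀ (A : Set (I → ℝ)) (n : ℕ), Metric.ediam A ≤ ENNReal.ofReal (((N : ℝ) ^ n)⁻¹) →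
      ν A ≤ 5 ^ Fintype.card I * ENNReal.ofReal ((c : ℝ)⁻¹ ^ n) := by
    intro A n hA
    refine (measure_mono subset_closure).trans ?_
    rw [Measure.map_apply hmeas isClosed_closure.measurableSet]
    exact uniformSeq_preimage_cosetPoint_le H e I (by rwa [Metric.ediam_closure])
  set K : ℝ≥0∞ := 5 ^ Fintype.card I * ENNReal.ofReal c
  have hK0 : K ≠ 0 := mul_ne_zero (by simp) (ENNReal.ofReal_pos.2 hc0).ne'
  have hKtop : K ≠ ⊤ := ENNReal.mul_ne_top (by simp) ENNReal.ofReal_ne_top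
  have hle : K⁻¹ • ν ≤ μH[s] := by
    refine Measure.le_hausdorffMeasure s _ 1 one_pos fun A hA => ?_
    rw [Measure.smul_apply, smul_eq_mul, ← ENNReal.div_eq_inv_mul]
    refine ENNReal.div_le_of_le_mul' ?_
    rcases eq_or_ne (Metric.ediam A) 0 with h0 | h0
    · rw [h0, ENNReal.zero_rpow_of_pos hs, mul_zero]
      have hlim : Tendsto (fun n : ℕ => (5 : ℝ≥0∞) ^ Fintype.card I * ENNReal.ofReal ((c : ℝ)⁻¹ ^ n))
          atTop (𝓝 0) := by
        have h1 := ENNReal.tendsto_ofReal (tendsto_pow_atTop_nhds_zero_of_lt_one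
          (inv_nonneg.2 hc0.le) (inv_lt_one_of_one_lt₀ hc1))
        rw [ENNReal.ofReal_zero] at h1
        have h2 := ENNReal.Tendsto.const_mul (a := (5 : ℝ≥0∞) ^ Fintype.card I) h1
          (Or.inr (by simp))
        rwa [mul_zero] at h2
      exact ge_of_tendsto' hlim fun n => hν A n (by rw [h0]; exact zero_le)
    -- Choose `n` with `N⁻⁽ⁿ⁺¹⁾ < diam A ≤ N⁻ⁿ`; the factor `c` in `K` pays for the step of scale.
    · have htop : Metric.ediam A ≠ ⊤ := ne_top_of_le_ne_top ENNReal.one_ne_top hA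
      obtain ⟨n, hn1, hn2⟩ := exists_nat_pow_near_of_lt_one (ENNReal.toReal_pos h0 htop)
        (ENNReal.toReal_le_of_le_ofReal zero_le_one (by simpa using hA))
        (inv_pos.2 hN0) (inv_lt_one_of_one_lt₀ (by exact_mod_cast hN : (1 : ℝ) < N))
      rw [inv_pow] at hn1 hn2
      refine (hν A n ((ENNReal.le_ofReal_iff_toReal_le htop (by positivity)).2 hn2)).trans ?_
      have h1 : ENNReal.ofReal ((c : ℝ)⁻¹ ^ n) =
          ENNReal.ofReal c * ENNReal.ofReal ((c : ℝ)⁻¹ ^ (n + 1)) := by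
        rw [← ENNReal.ofReal_mul hc0.le, pow_succ]
        congr 1
        field_simp
      rw [h1, ← hcs, ← mul_assoc]
      exact mul_le_mul_right (ENNReal.rpow_le_rpow
        ((ENNReal.ofReal_le_iff_le_toReal htop).2 hn1.le) hs.le) _
  have hH : μH[s] U = 0 := by
    have := hausdorffMeasure_of_dimH_lt (d := s.toNNReal) hU
    rwa [Real.coe_toNNReal _ hs.le] at this
  have hνU : ν U = 0 := by
    have := (Measure.le_iff'.1 hle U).trans_eq hH
    rw [Measure.smul_apply, smul_eq_mul, nonpos_iff_eq_zero, mul_eq_zero] at this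
    exact this.resolve_left (ENNReal.inv_ne_zero.2 hKtop)
  exact Measure.preimage_null_of_map_null hmeas.aemeasurable hνU

end

/-- The statement about dimensions fails for the Cantor-type set of coset digits if the coset
variables violate the inequality for entropies and are not constant. All bounds `a_I` are
proportional to the dimensions of the projections, by the same factor less than `1`. -/
lemma not_dimensionStatementFor_cantorSet {m N : ℕ} {G : Type} [Group G] [Finite G]
    {H : Fin m → Subgroup G} (e : ∀ i, (G ⧸ H i) ↪ Fin N) {𝓘 𝓙 : Finset (Finset (Fin m))}
    {lam mu : Finset (Fin m) → ℝ≥0} (hN : 2 ≤ N)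
    (hlt : ∑ J ∈ 𝓙, (mu J : ℝ) * cosetEntropy H J < ∑ I ∈ 𝓘, (lam I : ℝ) * cosetEntropy H I)
    (hpos : ∀ I ∈ 𝓘, 0 < cosetEntropy H I) :
    ¬ DimensionStatementFor 𝓘 𝓙 lam mu (cantorSet N (cosetDigits H e)) := by
  intro hD
  let _ : MeasurableSpace G := ⊤
  have hlogN : 0 < Real.log N := Real.log_pos (by exact_mod_cast hN)
  have hnn : ∀ I, 0 ≤ cosetEntropy H I := fun I => by
    rw [cosetEntropy_eq_log_ncard]
    exact Real.log_natCast_nonneg _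
  set A := ∑ J ∈ 𝓙, (mu J : ℝ) * cosetEntropy H J
  set B := ∑ I ∈ 𝓘, (lam I : ℝ) * cosetEntropy H I with hB
  have hA : 0 ≤ A := Finset.sum_nonneg fun J _ => mul_nonneg (NNReal.coe_nonneg _) (hnn J)
  have hB0 : 0 < B := hA.trans_lt hlt
  have hθ : A / B < 1 := (div_lt_one hB0).2 hlt
  let a : Finset (Fin m) → ℝ≥0 := fun I => (A / B * (cosetEntropy H I / Real.log N)).toNNReal
  obtain ⟨T, hT, hTd⟩ := hD a (by
    calc _ ≤ ∑ J ∈ 𝓙, (mu J : ℝ≥0∞) * ENNReal.ofReal (cosetEntropy H J / Real.log N) := by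
          gcongr with J
          exact packingDim_proj_cantorSet_le H e J hN
      _ = ENNReal.ofReal (A / Real.log N) := by
          rw [Finset.sum_div, ENNReal.ofReal_sum_of_nonneg fun J _ =>
            div_nonneg (mul_nonneg (NNReal.coe_nonneg _) (hnn J)) hlogN.le]
          refine Finset.sum_congr rfl fun J _ => ?_
          rw [mul_div_assoc, ENNReal.ofReal_mul (NNReal.coe_nonneg _), ENNReal.ofReal_coe_nnreal]
      _ = ENNReal.ofReal (∑ I ∈ 𝓘, (lam I : ℝ) * (A / B * (cosetEntropy H I / Real.log N))) := by
          congr 1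
          have : ∑ I ∈ 𝓘, (lam I : ℝ) * (A / B * (cosetEntropy H I / Real.log N)) =
              A / B / Real.log N * B := by
            rw [hB, Finset.mul_sum]
            exact Finset.sum_congr rfl fun I _ => by ring
          rw [this]
          field_simp
      _ ≤ _ := by
          rw [ENNReal.ofReal_sum_of_nonneg fun I _ => by have := hnn I; positivity]
          gcongr with I
          rw [ENNReal.ofReal_mul (NNReal.coe_nonneg _), ENNReal.ofReal_coe_nnreal]
          rfl)
  -- Every sequence of elements of `G` encodes a point of one of the parts, yet each part has
  -- measure zero.
  have hcov : (univ : Set (ℕ → G)) ⊆ ⋃ I ∈ 𝓘, cosetPoint H e I ⁻¹' proj I (T I) := by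
    intro d _
    have hx : (fun i => Real.ofDigits (cosetDigit H e d i)) ∈ cantorSet N (cosetDigits H e) :=
      ⟨fun k i => cosetDigit H e d i k, fun k => ⟨d k, rfl⟩, fun i => rfl⟩
    rw [hT] at hx
    obtain ⟨I, hI, hxI⟩ := mem_iUnion₂.1 hx
    exact mem_iUnion₂.2 ⟨I, hI, _, hxI, rfl⟩
  have hzero : uniformSeq G univ = 0 := by
    refine measure_mono_null hcov ((measure_biUnion_null_iff 𝓘.countable_toSet).2 fun I hI => ?_)
    refine uniformSeq_preimage_eq_zero_of_dimH_lt H e I hN (hpos I hI) ((hTd I hI).trans_lt ?_)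
    have hs : 0 < cosetEntropy H I / Real.log N := div_pos (hpos I hI) hlogN
    refine (ENNReal.ofReal_lt_ofReal_iff hs).2 ?_
    exact mul_lt_of_lt_one_left hs hθ
  rw [uniformSeq_univ] at hzero
  exact one_ne_zero hzero

end EntropyDim

theorem mainTheorem2 {m : ℕ} (𝓘 𝓙 : Finset (Finset (Fin m))) (lam mu : Finset (Fin m) → ℝ≥0)
    (h𝓘 : ∀ I ∈ 𝓘, I.Nonempty) (h𝓙 : ∀ J ∈ 𝓙, J.Nonempty) (hdisj : Disjoint 𝓘 𝓙)
    (hlam : ∀ I ∈ 𝓘, 0 < lam I) (hmu : ∀ J ∈ 𝓙, 0 < mu J) :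
    (¬ EntropyDim.EntropyInequality 𝓘 𝓙 lam mu → ¬ EntropyDim.DimensionStatement 𝓘 𝓙 lam mu) ∧
    (¬ EntropyDim.EntropyInequality 𝓘 𝓙 lam mu →
      ∃ (G : Type) (_ : Group G) (_ : Finite G) (H : Fin m → Subgroup G) (N : ℕ) (_ : 2 ≤ N)
        (e : ∀ i, (G ⧸ H i) ↪ Fin N),
        ∑ J ∈ 𝓙, (mu J : ℝ) * EntropyDim.cosetEntropy H J <
          ∑ I ∈ 𝓘, (lam I : ℝ) * EntropyDim.cosetEntropy H I ∧
        ¬ EntropyDim.DimensionStatementFor 𝓘 𝓙 lam mu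
          (EntropyDim.cantorSet N (EntropyDim.cosetDigits H e))) ∧
    (𝓘.Nonempty →
      (EntropyDim.EntropyInequality 𝓘 𝓙 lam mu ↔ EntropyDim.DimensionStatement 𝓘 𝓙 lam mu)) := by
  have key : ¬ EntropyDim.EntropyInequality 𝓘 𝓙 lam mu →
      ∃ (G : Type) (_ : Group G) (_ : Finite G) (H : Fin m → Subgroup G) (N : ℕ) (_ : 2 ≤ N)
        (e : ∀ i, (G ⧸ H i) ↪ Fin N),
        ∑ J ∈ 𝓙, (mu J : ℝ) * EntropyDim.cosetEntropy H J <
          ∑ I ∈ 𝓘, (lam I : ℝ) * EntropyDim.cosetEntropy H I ∧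
        ¬ EntropyDim.DimensionStatementFor 𝓘 𝓙 lam mu
          (EntropyDim.cantorSet N (EntropyDim.cosetDigits H e)) := by
    intro hE
    obtain ⟨G, _, _, H, hlt, hpos⟩ :=
      EntropyDim.exists_cosetEntropy_lt_of_not_entropyInequality h𝓘 hE
    have he : ∀ i, Nonempty ((G ⧸ H i) ↪ Fin (Nat.card G + 1)) := fun i => by
      have := Fintype.ofFinite (G ⧸ H i)
      refine Function.Embedding.nonempty_of_card_le ?_
      rw [Fintype.card_fin, ← Nat.card_eq_fintype_card]
      exact (Nat.card_le_card_of_surjective _ QuotientGroup.mk_surjective).trans (Nat.le_succ _)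
    have hN : 2 ≤ Nat.card G + 1 := Nat.succ_le_succ Nat.card_pos
    exact ⟨G, _, inferInstance, H, _, hN, fun i => (he i).some, hlt,
      EntropyDim.not_dimensionStatementFor_cantorSet _ hN hlt hpos⟩
  have not_dim : ¬ EntropyDim.EntropyInequality 𝓘 𝓙 lam mu →
      ¬ EntropyDim.DimensionStatement 𝓘 𝓙 lam mu := fun hE hD => by
    obtain ⟨_, _, _, _, _, _, _, _, h⟩ := key hE
    exact h (hD _)
  exact ⟨not_dim, key, fun h => ⟨fun hE => hE.dimensionStatement h hlam hmu,
    not_imp_not.1 not_dim⟩⟩
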